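/- Let $d\ge 1$, and let $q(x)=q_1(x_1)\cdots q_d(x_d)$ where each $q_i\ge 0$ is a probability density on $[-1,1]$. Order the monomials $x^\alpha$, $\alpha\in\mathbb N^d$, by the graded lexicographic order, the grade of $\alpha$ being either $\max_i\alpha_i$ or $\sum_i\alpha_i$ (the result holds for both), let $(\phi_k)_{k\ge 0}$ be the orthonormal polynomials obtained by applying Gram–Schmidt in $L^2(q(x)\,dx)$ on $[-1,1]^d$ to the ordered monomials, and put $K_q^{(p)}(x,y)=\sum_{k=0}^{p-1}\phi_k(x)\phi_k(y)$. The orthogonal polynomial ensemble $\mathrm{DPP}(K_q^{(p)},q)$ is the random set $\{w_1,\dots,w_p\}$, where $(w_1,\dots,w_p)$ has density $\frac1{p!}\det[K_q^{(p)}(w_i,w_l)]_{i,l=1}^p$ with respect to $\prod_i q(w_i)\,dw_i$ on $([-1,1]^d)^p$. Let $z_1,z_2,\dots$ be i.i.d. random points of $\mathbb R^d$ with law $\gamma$, and $\mathfrak D_N=(z_1,\dots,z_N)$. Let $\Theta\subset\mathbb R^m$, and let $\mathcal L:\mathbb R^d\times\mathbb R^m\to\mathbb R$ be such that, for $\gamma$-almost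 every $z$, $\mathcal L(z,\cdot)$ is differentiable at every $\theta\in\Theta$. Let $k:\mathbb R^d\to\mathbb R$ be a smoothing kernel, and for each $N$ let $p=p_N\ge 1$ be an integer and $h=h_N>0$. Put $$\widehat{\nabla_\theta\mathcal L}(w,\theta)=\frac1{Nh^d}\sum_{i=1}^N\nabla_\theta\mathcal L(z_i,\theta)\,k\Big(\frac{w-z_i}{h}\Big),\qquad F_N(w,\theta)=\frac{\widehat{\nabla_\theta\mathcal L}(w,\theta)}{q(w)\cdot\frac1pK_q^{(p)}(w,w)}.$$ For each $N$, let $A=A_N\sim\mathrm{DPP}(K_q^{(p)},q)$ be independent of $\mathfrak D_N$, and let $$\Xi_{A,\mathrm s}(\theta)=\sum_{w\in A}\frac{\widehat{\nabla_\theta\mathcal L}(w,\theta)}{q(w)K_q^{(p)}(w,w)}.$$ Here, for $X_N\in[0,\infty]$ and deterministic $a_N\ge0$, $X_N=\mathcal O_P(a_N)$ means that for every $\varepsilon>0$ there is a finite $C$ such that $\mathbb P(X_N>Ca_N)\le\varepsilon$ for all large $N$; if $X_N$ is not measurable, $\mathbb P$ is read as outer probability. The variance of a random vector $Y$ is $\mathbb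 E\|Y-\mathbb EY\|_2^2$, and $\mathrm{Var}[\,\cdot\,|\mathfrak D_N]$ is the variance under the conditional law of $A_N$ given $\mathfrak D_N$. Assume that there are random constants $B_N,M_N\ge 0$, not depending on $\theta$, with $B_N=\mathcal O_P(1)$ and $M_N=\mathcal O_P(1)$, such that for every $N$, almost surely, for all $\theta\in\Theta$, the map $w\mapsto F_N(w,\theta)$ is bounded in norm by $B_N$ and Lipschitz with constant $M_N$ on $\{w\in[-1,1]^d: q(w)>0\}$. Then, as $N\to\infty$, $$\sup_{\theta\in\Theta}\mathrm{Var}\big[\Xi_{A,\mathrm s}(\theta)\,\big|\,\mathfrak D_N\big]=\mathcal O_P\big(p_N^{-(1+1/d)}\big).$$ -/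

import Mathlib

open MeasureTheory ProbabilityTheory Filter
open scoped NNReal ENNReal

namespace OPESmoothed

/-! ### Ordering of the monomials -/

/-- The maximal degree `max_i α_i` of a multi-index (the grading for which the first `m ^ d`
multi-indices are exactly `{0, …, m-1}^d`). -/
def maxDegree {d : ℕ} (α : Fin d → ℕ) : ℕ := Finset.univ.sup α

/-- The total degree `∑_i α_i` of a multi-index. -/
def totalDegree {d : ℕ} (α : Fin d → ℕ) : ℕ := ∑ i, α i

/-- The graded lexicographic order on multi-indices attached to a grading: compare the grades
first, and break ties lexicographically. -/
def GradedLexLT {d : ℕ} (grade : (Fin d → ℕ) → ℕ) (α β : Fin d → ℕ) : Prop :=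
  grade α < grade β ∨ (grade α = grade β ∧ toLex α < toLex β)

/-- The number of multi-indices that strictly precede `α`. -/
noncomputable def gradedLexRank {d : ℕ} (grade : (Fin d → ℕ) → ℕ) (α : Fin d → ℕ) : ℕ :=
  Set.ncard {β | GradedLexLT grade β α}

/-- The `n`-th multi-index (starting from `n = 0`) in the graded lexicographic order: the one with
exactly `n` predecessors. See `gradedLexRank_bijective`. -/
noncomputable def gradedLexEnum {d : ℕ} (grade : (Fin d → ℕ) → ℕ) (n : ℕ) : Fin d → ℕ :=
  Function.invFun (gradedLexRank grade) n

theorem gradedLexRank_bijective {d : ℕ} (hd : 0 < d) (grade : (Fin d → ℕ) → ℕ)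
    (hgrade : grade = maxDegree ∨ grade = totalDegree) :
    Function.Bijective (gradedLexRank grade) := by
  have hle : ∀ α : Fin d → ℕ, ∀ i, α i ≤ grade α := by
    intro α i
    rcases hgrade with h | h
    · rw [h]; exact Finset.le_sup (f := α) (Finset.mem_univ i)
    · rw [h]; exact Finset.single_le_sum (f := α) (fun _ _ => Nat.zero_le _) (Finset.mem_univ i)
  have hfin : ∀ α, {β | GradedLexLT grade β α}.Finite := by
    intro α
    apply (Set.finite_Iic (fun _ : Fin d => grade α)).subset
    intro β hβ i
    refine (hle β i).trans ?_
    rcases hβ with h | h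
    · exact h.le
    · exact h.1.le
  have htrans : ∀ α β γ, GradedLexLT grade α β → GradedLexLT grade β γ →
      GradedLexLT grade α γ := by
    intro α β γ h1 h2
    rcases h1 with h1 | h1 <;> rcases h2 with h2 | h2
    · exact Or.inl (h1.trans h2)
    · exact Or.inl (h2.1 ▸ h1)
    · exact Or.inl (h1.1 ▸ h2)
    · exact Or.inr ⟨h1.1.trans h2.1, h1.2.trans h2.2⟩
  have hirr : ∀ α, ¬ GradedLexLT grade α α := by
    intro α h
    rcases h with h | h
    · exact lt_irrefl _ h
    · exact lt_irrefl _ h.2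
  have htri : ∀ α β, α ≠ β → GradedLexLT grade α β ∨ GradedLexLT grade β α := by
    intro α β hne
    rcases lt_trichotomy (grade α) (grade β) with h | h | h
    · exact Or.inl (Or.inl h)
    · rcases lt_trichotomy (toLex α) (toLex β) with h' | h' | h'
      · exact Or.inl (Or.inr ⟨h, h'⟩)
      · exact absurd (toLex.injective h') hne
      · exact Or.inr (Or.inr ⟨h.symm, h'⟩)
    · exact Or.inr (Or.inl h)
  have hmono : ∀ α β, GradedLexLT grade α β → gradedLexRank grade α < gradedLexRank grade β := by
    intro α β h
    refine Set.ncard_lt_ncard ?_ (hfin β)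
    refine ⟨fun γ hγ => htrans γ α β hγ h, fun hsub => hirr α (hsub h)⟩
  have hinj : Function.Injective (gradedLexRank grade) := by
    intro α β h
    by_contra hne
    rcases htri α β hne with h' | h'
    · exact absurd h (hmono _ _ h').ne
    · exact absurd h (hmono _ _ h').ne'
  refine ⟨hinj, fun n => ?_⟩
  -- some multi-index has rank at least `n`; the ranks of its predecessors fill an initial segment
  have : Nonempty (Fin d) := ⟨⟨0, hd⟩⟩
  obtain ⟨γ, hγ⟩ : ∃ γ, n < gradedLexRank grade γ := by
    by_contra! hcon
    exact Set.infinite_univ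
      ((Set.finite_Iic n).preimage (f := gradedLexRank grade) hinj.injOn |>.subset
        (fun α _ => hcon α))
  have himg : gradedLexRank grade '' {β | GradedLexLT grade β γ}
      = Set.Iio (gradedLexRank grade γ) := by
    apply Set.eq_of_subset_of_ncard_le
    · rintro _ ⟨β, hβ, rfl⟩
      exact hmono _ _ hβ
    · rw [Set.ncard_image_of_injective _ hinj]
      have : (Set.Iio (gradedLexRank grade γ)).ncard = gradedLexRank grade γ := by
        rw [← Finset.coe_Iio, Set.ncard_coe_finset, Nat.card_Iio]
      rw [this]; rfl
    · exact Set.finite_Iio _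
  have hn : n ∈ Set.Iio (gradedLexRank grade γ) := hγ
  rw [← himg] at hn
  obtain ⟨β, -, hβ⟩ := hn
  exact ⟨β, hβ⟩

/-- The `n`-th monomial `x_1^{α_1} ⋯ x_d^{α_d}`. -/
noncomputable def orderedMonomial {d : ℕ} (grade : (Fin d → ℕ) → ℕ) (n : ℕ) :
    MvPolynomial (Fin d) ℝ :=
  ∏ i, MvPolynomial.X i ^ gradedLexEnum grade n i

/-! ### Orthonormal polynomials and the orthogonal polynomial ensemble -/

/-- Value of a polynomial at a point of Euclidean space. -/
noncomputable def evalAt {d : ℕ} (x : EuclideanSpace ℝ (Fin d)) (P : MvPolynomial (Fin d) ℝ) : ℝ :=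
  MvPolynomial.eval (fun i => x i) P

/-- The inner product `∫ P Q dμ` of `L²(μ)` on polynomials. -/
noncomputable def polyInner {d : ℕ} (μ : Measure (EuclideanSpace ℝ (Fin d)))
    (P Q : MvPolynomial (Fin d) ℝ) : ℝ :=
  ∫ x, evalAt x P * evalAt x Q ∂μ

/-- The orthonormal polynomials `φ_0, φ_1, …` of `μ`: the Gram–Schmidt algorithm in `L²(μ)`
applied to the ordered monomials. -/
noncomputable def orthoPoly {d : ℕ} (grade : (Fin d → ℕ) → ℕ)
    (μ : Measure (EuclideanSpace ℝ (Fin d))) (n : ℕ) : MvPolynomial (Fin d) ℝ :=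
  let r : MvPolynomial (Fin d) ℝ := orderedMonomial grade n -
    ∑ k : Fin n, polyInner μ (orderedMonomial grade n) (orthoPoly grade μ k) • orthoPoly grade μ k
  (Real.sqrt (polyInner μ r r))⁻¹ • r
termination_by n
decreasing_by all_goals exact k.2

/-- The kernel `K_μ^{(p)}(x, y) = ∑_{k < p} φ_k(x) φ_k(y)`. -/
noncomputable def opeKernel {d : ℕ} (grade : (Fin d → ℕ) → ℕ)
    (μ : Measure (EuclideanSpace ℝ (Fin d))) (p : ℕ) (x y : EuclideanSpace ℝ (Fin d)) : ℝ :=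
  ∑ k ∈ Finset.range p, evalAt x (orthoPoly grade μ k) * evalAt y (orthoPoly grade μ k)

/-- Law of the (exchangeable) points `x_1, …, x_p` of the projection determinantal point process
with kernel `K` of rank `p` and reference measure `μ`: the joint density with respect to `μ^{⊗p}`
is `(1 / p!) det [K(x_i, x_l)]`. -/
noncomputable def projectionDPP {X : Type*} [MeasurableSpace X] (μ : Measure X) (K : X → X → ℝ)
    (p : ℕ) : Measure (Fin p → X) :=
  (Measure.pi fun _ : Fin p => μ).withDensity fun x =>
    ENNReal.ofReal ((p.factorial : ℝ)⁻¹ * (Matrix.of fun i l => K (x i) (x l)).det)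

/-- The cube `[-1, 1]^d`. -/
def cube (d : ℕ) : Set (EuclideanSpace ℝ (Fin d)) := {x | ∀ i, x i ∈ Set.Icc (-1 : ℝ) 1}

/-- The separable density `q(x) = q_1(x_1) ⋯ q_d(x_d)`. -/
noncomputable def prodDensity {d : ℕ} (q : Fin d → ℝ → ℝ) (x : EuclideanSpace ℝ (Fin d)) : ℝ :=
  ∏ i, q i (x i)

/-- The measure `q(x) dx` on `[-1, 1]^d`. -/
noncomputable def refMeasure {d : ℕ} (q : Fin d → ℝ → ℝ) : Measure (EuclideanSpace ℝ (Fin d)) :=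
  (volume.restrict (cube d)).withDensity fun x => ENNReal.ofReal (prodDensity q x)

/-- The multivariate OPE kernel `K_q^{(p)}`. -/
noncomputable def kernelQ {d : ℕ} (grade : (Fin d → ℕ) → ℕ) (q : Fin d → ℝ → ℝ) (p : ℕ)
    (x y : EuclideanSpace ℝ (Fin d)) : ℝ :=
  opeKernel grade (refMeasure q) p x y

/-- The multivariate orthogonal polynomial ensemble `DPP(K_q^{(p)}, q)`. -/
noncomputable def opeLaw {d : ℕ} (grade : (Fin d → ℕ) → ℕ) (q : Fin d → ℝ → ℝ) (p : ℕ) :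
    Measure (Fin p → EuclideanSpace ℝ (Fin d)) :=
  projectionDPP (refMeasure q) (kernelQ grade q p) p

/-! ### The smoothed gradient estimator -/

/-- The kernel estimator `(N h^d)⁻¹ ∑_i ∇_θ ℒ(z_i, θ) k((z - z_i) / h)` of the gradient. -/
noncomputable def smoothedGradient {d m N : ℕ}
    (loss : EuclideanSpace ℝ (Fin d) → EuclideanSpace ℝ (Fin m) → ℝ)
    (k : EuclideanSpace ℝ (Fin d) → ℝ) (h : ℝ) (data : Fin N → EuclideanSpace ℝ (Fin d))
    (θ : EuclideanSpace ℝ (Fin m)) (z : EuclideanSpace ℝ (Fin d)) : EuclideanSpace ℝ (Fin m) :=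
  ((N : ℝ) * h ^ d)⁻¹ • ∑ i, k (h⁻¹ • (z - data i)) • gradient (loss (data i)) θ

/-- The estimator `Ξ_{A,s} = ∑_j (q(w_j) K_q^{(p)}(w_j, w_j))⁻¹ (smoothed gradient at w_j)`. -/
noncomputable def smoothedEstimator {d m N p : ℕ} (grade : (Fin d → ℕ) → ℕ) (q : Fin d → ℝ → ℝ)
    (loss : EuclideanSpace ℝ (Fin d) → EuclideanSpace ℝ (Fin m) → ℝ)
    (k : EuclideanSpace ℝ (Fin d) → ℝ) (h : ℝ) (θ : EuclideanSpace ℝ (Fin m))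
    (data : Fin N → EuclideanSpace ℝ (Fin d)) (A : Fin p → EuclideanSpace ℝ (Fin d)) :
    EuclideanSpace ℝ (Fin m) :=
  ∑ j, (prodDensity q (A j) * kernelQ grade q p (A j) (A j))⁻¹ •
    smoothedGradient loss k h data θ (A j)

/-- The normalized smoothed gradient `(q(w) · (1/p) K_q^{(p)}(w, w))⁻¹ (smoothed gradient at w)`. -/
noncomputable def normalizedGradient {d m N : ℕ} (grade : (Fin d → ℕ) → ℕ) (q : Fin d → ℝ → ℝ)
    (p : ℕ) (loss : EuclideanSpace ℝ (Fin d) → EuclideanSpace ℝ (Fin m) → ℝ)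
    (k : EuclideanSpace ℝ (Fin d) → ℝ) (h : ℝ) (data : Fin N → EuclideanSpace ℝ (Fin d))
    (θ : EuclideanSpace ℝ (Fin m)) (w : EuclideanSpace ℝ (Fin d)) : EuclideanSpace ℝ (Fin m) :=
  (prodDensity q w * ((1 / (p : ℝ)) * kernelQ grade q p w w))⁻¹ •
    smoothedGradient loss k h data θ w

/-! ### Probabilistic notions -/

/-- The variance `E ‖Y - E Y‖²` (trace of the covariance matrix) of a random vector `Y` under `μ`,
with values in `[0, ∞]`. -/
noncomputable def vectorVariance {S G : Type*} [MeasurableSpace S] [NormedAddCommGroup G]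
    [NormedSpace ℝ G] (Y : S → G) (μ : Measure S) : ℝ≥0∞ :=
  ∫⁻ a, ‖Y a - ∫ b, Y b ∂μ‖ₑ ^ 2 ∂μ

/-- The conditional variance `Var[Y(D, A) | D]` of a function `Y` of the random elements `D` and
`A`: the variance of `Y(D(ω), ·)` under the conditional law of `A` given `D`. -/
noncomputable def condVariance {Ω R S G : Type*} [MeasurableSpace Ω] [MeasurableSpace R]
    [MeasurableSpace S] [StandardBorelSpace S] [Nonempty S] [NormedAddCommGroup G]
    [NormedSpace ℝ G] (P : Measure Ω) [IsFiniteMeasure P] (D : Ω → R) (A : Ω → S)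
    (Y : R → S → G) (ω : Ω) : ℝ≥0∞ :=
  vectorVariance (Y (D ω)) (condDistrib A D P (D ω))

/-- `X_N = O_P(a_N)` as `N → ∞`, for nonnegative `X_N` and deterministic `a_N ≥ 0`: for every
`ε > 0` there is a constant `C` with `P(X_N > C a_N) ≤ ε` for all large `N`. -/
def IsBigOP {Ω : Type*} [MeasurableSpace Ω] (P : Measure Ω) (X : ℕ → Ω → ℝ≥0∞) (a : ℕ → ℝ≥0∞) :
    Prop :=
  ∀ ε : ℝ≥0∞, 0 < ε → ∃ C : ℝ≥0, ∀ᶠ N in atTop, P {ω | (C : ℝ≥0∞) * a N < X N ω} ≤ ε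

end OPESmoothed

/-! Conditionally on the data, independence leaves the law of `A` unchanged, and the estimator is
`p⁻¹ ∑ F(w_j)` with `F` the normalized gradient. It therefore suffices to bound the variance of a
Lipschitz linear statistic of the ensemble, with a constant depending on `F` only through its
Lipschitz constant `M`; uniformity in `θ` is then automatic.

For a projection DPP this variance is `½ ∬ ‖F x - F y‖² K(x,y)² dμ dμ`, which is monotone in the
increments of `F`. Hence it is at most `M²` times the sum of the variances of the coordinate
statistics (`sum_blockVariance_le`).

For the coordinate `x_i`, the variance is the squared Hilbert–Schmidt norm of the part of
multiplication by `x_i` that leaves the span of `φ_0, …, φ_{p-1}`. On the cube this is a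
contraction, and it kills every polynomial with no coefficient on an exponent pushed out of the
first `p` by adding `e_i`. So the norm is at most the number of such exponents
(`blockVariance_coord_le`). The first `p` exponents form a lower set of width `O(p^{1/d})`, whose
boundary in direction `i` has `O(p^{1-1/d})` points (`ncard_boundaryExponents_le`). The factor `p⁻²`
gives the rate. No asymptotics of the kernel and no regularity of `q` are needed. -/

namespace OPESmoothed

/-! ### Moments of projection determinantal point processes -/

section ProjectionDPP

variable {X : Type*} {p : ℕ}

/-- The projection kernel `∑_k φ_k(x) φ_k(y)`. -/
def projKernel (φ : Fin p → X → ℝ) (x y : X) : ℝ := ∑ k, φ k x * φ k y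

theorem det_projKernel_eq_sq (φ : Fin p → X → ℝ) (x : Fin p → X) :
    (Matrix.of fun i l => projKernel φ (x i) (x l)).det
      = (Matrix.of fun k i => φ k (x i)).det ^ 2 := by
  have : (Matrix.of fun i l => projKernel φ (x i) (x l))
      = (Matrix.of fun k i => φ k (x i)).transpose * (Matrix.of fun k i => φ k (x i)) := by
    ext i l
    simp [projKernel, Matrix.mul_apply]
  rw [this, Matrix.det_mul, Matrix.det_transpose, sq]

theorem det_projKernel_nonneg (φ : Fin p → X → ℝ) (x : Fin p → X) :
    0 ≤ (Matrix.of fun i l => projKernel φ (x i) (x l)).det := by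
  rw [det_projKernel_eq_sq]
  positivity

/-- The sign of `σ` from one determinant is absorbed by permuting the rows of the other. Each
remaining term is a product of functions of one variable, ready for Fubini. -/
theorem det_projKernel_eq_sum (φ : Fin p → X → ℝ) (x : Fin p → X) :
    (Matrix.of fun i l => projKernel φ (x i) (x l)).det
      = ∑ σ : Equiv.Perm (Fin p), ∑ ρ : Equiv.Perm (Fin p), (Equiv.Perm.sign ρ : ℝ) *
          ∏ i, (φ (σ (ρ i)) (x i) * φ (σ i) (x i)) := by
  rw [det_projKernel_eq_sq, sq]
  conv_lhs => rw [Matrix.det_apply' (Matrix.of fun k i => φ k (x i)), Finset.sum_mul]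
  refine Finset.sum_congr rfl fun σ _ => ?_
  rw [← Matrix.det_apply' (Matrix.of fun k i => φ k (x i))]
  have h := Matrix.det_permute σ (Matrix.of fun k i => φ k (x i))
  rw [mul_right_comm, ← h, Matrix.det_apply', Finset.sum_mul]
  refine Finset.sum_congr rfl fun ρ _ => ?_
  rw [mul_assoc, ← Finset.prod_mul_distrib]
  rfl

theorem toReal_dppDensity (φ : Fin p → X → ℝ) (x : Fin p → X) :
    (ENNReal.ofReal ((p.factorial : ℝ)⁻¹ *
      (Matrix.of fun i l => projKernel φ (x i) (x l)).det)).toReal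
      = (p.factorial : ℝ)⁻¹ * (Matrix.of fun i l => projKernel φ (x i) (x l)).det :=
  ENNReal.toReal_ofReal (mul_nonneg (by positivity) (det_projKernel_nonneg φ x))

/-- Padding with the constant `1` lets a single identity for product test functions yield both the
first and the second moments. -/
theorem prod_update_one (f : X → ℝ) (i : Fin p) (x : Fin p → X) :
    ∏ j, Function.update (fun _ _ => (1 : ℝ)) i f j (x j) = f (x i) := by
  rw [Finset.prod_eq_single i]
  · simp
  · intro j _ hj
    simp [Function.update_of_ne hj]
  · exact fun h => absurd (Finset.mem_univ _) h

theorem prod_update_update_one (f : X → ℝ) {i j : Fin p} (hij : i ≠ j) (x : Fin p → X) :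
    ∏ l, Function.update (Function.update (fun _ _ => (1 : ℝ)) i f) j f l (x l)
      = f (x i) * f (x j) := by
  rw [Finset.prod_eq_mul i j hij]
  · simp [Function.update_of_ne hij]
  · intro l _ hl
    simp [Function.update_of_ne hl.1, Function.update_of_ne hl.2]
  · exact fun h => absurd (Finset.mem_univ _) h
  · exact fun h => absurd (Finset.mem_univ _) h

variable [MeasurableSpace X] {μ : Measure X} {φ : Fin p → X → ℝ}

theorem memLp_top_integrable [IsFiniteMeasure μ] {f : X → ℝ} (hf : MemLp f ⊤ μ) :
    Integrable f μ :=
  (hf.mono_exponent (p := 1) le_top).integrable le_rfl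

theorem integrable_prod_mul_det [IsFiniteMeasure μ] (hφ : ∀ k, MemLp (φ k) ⊤ μ)
    {G : Fin p → X → ℝ} (hG : ∀ i, MemLp (G i) ⊤ μ) :
    Integrable (fun x : Fin p → X => (∏ i, G i (x i)) *
      (Matrix.of fun i l => projKernel φ (x i) (x l)).det) (Measure.pi fun _ => μ) := by
  simp_rw [det_projKernel_eq_sum, Finset.mul_sum]
  refine integrable_finsetSum _ fun σ _ => integrable_finsetSum _ fun ρ _ => ?_
  simp_rw [mul_left_comm _ (Equiv.Perm.sign ρ : ℝ), ← Finset.prod_mul_distrib]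
  refine Integrable.const_mul ?_ _
  exact Integrable.fintype_prod
    (f := fun i y => G i y * (φ (σ (ρ i)) y * φ (σ i) y)) fun i =>
      memLp_top_integrable (((hφ _).mul (r := ⊤) (hφ _)).mul (r := ⊤) (hG i))

/-- **Andréief's identity** with one test function per variable. -/
theorem integral_prod_mul_det [IsFiniteMeasure μ] (hφ : ∀ k, MemLp (φ k) ⊤ μ)
    {G : Fin p → X → ℝ} (hG : ∀ i, MemLp (G i) ⊤ μ) :
    ∫ x : Fin p → X, (∏ i, G i (x i)) *
      (Matrix.of fun i l => projKernel φ (x i) (x l)).det ∂(Measure.pi fun _ => μ)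
      = ∑ σ : Equiv.Perm (Fin p),
        (Matrix.of fun l i => ∫ y, G i y * (φ (σ l) y * φ (σ i) y) ∂μ).det := by
  have hint : ∀ σ ρ : Equiv.Perm (Fin p), Integrable (fun x : Fin p → X =>
      (Equiv.Perm.sign ρ : ℝ) * ∏ i, (G i (x i) * (φ (σ (ρ i)) (x i) * φ (σ i) (x i))))
      (Measure.pi fun _ => μ) := fun σ ρ =>
    (Integrable.fintype_prod
      (f := fun i y => G i y * (φ (σ (ρ i)) y * φ (σ i) y)) fun i =>
        memLp_top_integrable (((hφ _).mul (r := ⊤) (hφ _)).mul (r := ⊤) (hG i))).const_mul _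
  simp_rw [det_projKernel_eq_sum, Finset.mul_sum,
    mul_left_comm _ (Int.cast (R := ℝ) _), ← Finset.prod_mul_distrib]
  rw [integral_finsetSum _ fun σ _ => integrable_finsetSum _ fun ρ _ => hint σ ρ]
  refine Finset.sum_congr rfl fun σ _ => ?_
  rw [integral_finsetSum _ fun ρ _ => hint σ ρ, Matrix.det_apply']
  refine Finset.sum_congr rfl fun ρ _ => ?_
  rw [integral_const_mul, integral_fintype_prod_eq_prod
    (f := fun i y => G i y * (φ (σ (ρ i)) y * φ (σ i) y))]
  rfl

theorem det_eq_of_col_eq_one {n : Type*} [Fintype n] [DecidableEq n] (N : Matrix n n ℝ) (i : n)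
    (hN : ∀ l j, j ≠ i → N l j = if l = j then 1 else 0) : N.det = N i i := by
  rw [Matrix.det_apply', Finset.sum_eq_single 1]
  · simp only [Equiv.Perm.sign_one, Units.val_one, Int.cast_one, one_mul, Equiv.Perm.one_apply]
    refine Finset.prod_eq_single i (fun j _ hj => ?_) (fun h => absurd (Finset.mem_univ _) h)
    simp [hN j j hj]
  · intro ρ _ hρ
    obtain ⟨j, hj, hji⟩ : ∃ j, ρ j ≠ j ∧ j ≠ i := by
      by_contra! hcon
      refine hρ (Equiv.ext fun j => ?_)
      by_cases hj : ρ j = j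
      · exact hj
      · have h1 := hcon j hj
        exact (hcon (ρ j) fun h => hj (ρ.injective h)).trans h1.symm
    rw [Finset.prod_eq_zero (Finset.mem_univ j), mul_zero]
    rw [hN _ _ hji, if_neg hj]
  · exact fun h => absurd (Finset.mem_univ _) h

/-- Only the identity and the transposition of `i` and `j` fix every other index, so the Leibniz
expansion has two surviving terms. -/
theorem det_eq_of_cols_eq_one {n : Type*} [Fintype n] [DecidableEq n] (N : Matrix n n ℝ) {i j : n}
    (hij : i ≠ j) (hN : ∀ l m, m ≠ i → m ≠ j → N l m = if l = m then 1 else 0) :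
    N.det = N i i * N j j - N j i * N i j := by
  have hne : (1 : Equiv.Perm n) ≠ Equiv.swap i j := fun h => hij (by
    have := congrArg (fun e : Equiv.Perm n => e j) h
    simpa using this.symm)
  rw [Matrix.det_apply', Finset.sum_eq_add_of_mem (1 : Equiv.Perm n) (Equiv.swap i j)
    (Finset.mem_univ _) (Finset.mem_univ _) hne]
  · rw [Finset.prod_eq_mul_of_mem i j (Finset.mem_univ _) (Finset.mem_univ _) hij,
      Finset.prod_eq_mul_of_mem i j (Finset.mem_univ _) (Finset.mem_univ _) hij]
    · simp [Equiv.Perm.sign_swap hij]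
      ring
    · intro m _ hm
      rw [Equiv.swap_apply_of_ne_of_ne hm.1 hm.2, hN _ _ hm.1 hm.2, if_pos rfl]
    · intro m _ hm
      rw [Equiv.Perm.one_apply, hN _ _ hm.1 hm.2, if_pos rfl]
  · intro ρ _ hρ
    obtain ⟨m, hm, hmi, hmj⟩ : ∃ m, ρ m ≠ m ∧ m ≠ i ∧ m ≠ j := by
      by_contra! hcon
      have hfix : ∀ m, m ≠ i → m ≠ j → ρ m = m := by
        intro m hmi hmj
        by_contra h
        exact hmj (hcon m h hmi)
      have key : ∀ m, m = i ∨ m = j → ρ m = i ∨ ρ m = j := by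
        intro m hm
        by_contra! h
        have := ρ.injective (hfix _ h.1 h.2)
        rcases hm with hm | hm
        · exact h.1 (this.trans hm)
        · exact h.2 (this.trans hm)
      rcases key i (Or.inl rfl) with h1 | h1
      · refine hρ.1 (Equiv.ext fun m => ?_)
        by_cases hmi : m = i
        · simp [hmi, h1]
        by_cases hmj : m = j
        · rcases key j (Or.inr rfl) with h2 | h2
          · exact absurd (ρ.injective (h1.trans h2.symm)) hij
          · simp [hmj, h2]
        · simp [hfix m hmi hmj]
      · refine hρ.2 (Equiv.ext fun m => ?_)
        by_cases hmi : m = i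
        · simp [hmi, h1]
        by_cases hmj : m = j
        · rcases key j (Or.inr rfl) with h2 | h2
          · simp [hmj, h2]
          · exact absurd (ρ.injective (h1.trans h2.symm)) hij
        · rw [hfix m hmi hmj, Equiv.swap_apply_of_ne_of_ne hmi hmj]
    rw [Finset.prod_eq_zero (Finset.mem_univ m), mul_zero]
    rw [hN _ _ hmi hmj, if_neg hm]

end ProjectionDPP

/-! ### Means and variances of linear statistics -/

section ProjectionDPPVariance

variable {X : Type*} [MeasurableSpace X] {μ : Measure X} {p : ℕ} {φ : Fin p → X → ℝ}

theorem measurable_dppDensity (hφm : ∀ k, Measurable (φ k)) :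
    Measurable fun x : Fin p → X => ((p.factorial : ℝ)⁻¹ *
      (Matrix.of fun i l => projKernel φ (x i) (x l)).det) := by
  simp_rw [det_projKernel_eq_sum]
  fun_prop

theorem integrable_prod_projectionDPP [IsFiniteMeasure μ] (hφm : ∀ k, Measurable (φ k))
    (hφ : ∀ k, MemLp (φ k) ⊤ μ) {G : Fin p → X → ℝ} (hG : ∀ i, MemLp (G i) ⊤ μ) :
    Integrable (fun x : Fin p → X => ∏ i, G i (x i)) (projectionDPP μ (projKernel φ) p) := by
  rw [projectionDPP, integrable_withDensity_iff_integrable_smul'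
    (measurable_dppDensity hφm).ennreal_ofReal (ae_of_all _ fun _ => ENNReal.ofReal_lt_top)]
  simp_rw [toReal_dppDensity, smul_eq_mul, mul_assoc,
    mul_comm (Matrix.det _) (∏ i, G i _)]
  exact (integrable_prod_mul_det hφ hG).const_mul _

theorem integral_prod_projectionDPP [IsFiniteMeasure μ] (hφm : ∀ k, Measurable (φ k))
    (hφ : ∀ k, MemLp (φ k) ⊤ μ) {G : Fin p → X → ℝ} (hG : ∀ i, MemLp (G i) ⊤ μ) :
    ∫ x, ∏ i, G i (x i) ∂(projectionDPP μ (projKernel φ) p)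
      = (p.factorial : ℝ)⁻¹ * ∑ σ : Equiv.Perm (Fin p),
        (Matrix.of fun l i => ∫ y, G i y * (φ (σ l) y * φ (σ i) y) ∂μ).det := by
  rw [projectionDPP, integral_withDensity_eq_integral_toReal_smul₀
    (measurable_dppDensity hφm).ennreal_ofReal.aemeasurable
    (ae_of_all _ fun _ => ENNReal.ofReal_lt_top)]
  simp_rw [toReal_dppDensity, smul_eq_mul, mul_assoc,
    mul_comm (Matrix.det (n := Fin p) (Matrix.of fun i l => projKernel φ _ _)) (∏ i, G i _)]
  rw [integral_const_mul, integral_prod_mul_det hφ hG]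

/-- The matrix of the compression of multiplication by `f` to the span of the `φ_k`. -/
noncomputable def compression (μ : Measure X) (φ : Fin p → X → ℝ) (f : X → ℝ) (k l : Fin p) : ℝ :=
  ∫ y, f y * (φ k y * φ l y) ∂μ

theorem compression_comm (f : X → ℝ) (k l : Fin p) :
    compression μ φ f k l = compression μ φ f l k := by
  simp_rw [compression, mul_comm (φ k _)]

theorem memLp_top_one [IsFiniteMeasure μ] : MemLp (fun _ : X => (1 : ℝ)) ⊤ μ :=
  memLp_top_const 1

theorem memLp_update {f : X → ℝ} (hf : MemLp f ⊤ μ) {G : Fin p → X → ℝ}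
    (hG : ∀ i, MemLp (G i) ⊤ μ) (i j : Fin p) : MemLp (Function.update G i f j) ⊤ μ := by
  by_cases h : j = i
  · subst h; simpa using hf
  · simpa [Function.update_of_ne h] using hG j

theorem integrable_eval_projectionDPP [IsFiniteMeasure μ] (hφm : ∀ k, Measurable (φ k))
    (hφ : ∀ k, MemLp (φ k) ⊤ μ) {f : X → ℝ} (hf : MemLp f ⊤ μ) (i : Fin p) :
    Integrable (fun x : Fin p → X => f (x i)) (projectionDPP μ (projKernel φ) p) := by
  have := integrable_prod_projectionDPP hφm hφ (memLp_update hf (fun _ => memLp_top_one) i)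
  simpa only [prod_update_one] using this

/-- By orthonormality, every column carrying the test function `1` in Andréief's determinant is a
column of the identity. The average over `σ` disappears only after summing over the points. -/
theorem integral_eval_projectionDPP [IsFiniteMeasure μ] (hφm : ∀ k, Measurable (φ k))
    (hφ : ∀ k, MemLp (φ k) ⊤ μ) (hon : ∀ k l, ∫ y, φ k y * φ l y ∂μ = if k = l then 1 else 0)
    {f : X → ℝ} (hf : MemLp f ⊤ μ) (i : Fin p) :
    ∫ x, f (x i) ∂(projectionDPP μ (projKernel φ) p)
      = (p.factorial : ℝ)⁻¹ * ∑ σ : Equiv.Perm (Fin p), compression μ φ f (σ i) (σ i) := by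
  have := integral_prod_projectionDPP hφm hφ (memLp_update hf (fun _ => memLp_top_one) i)
  simp only [prod_update_one] at this
  rw [this]
  congr 1
  refine Finset.sum_congr rfl fun σ _ => ?_
  rw [det_eq_of_col_eq_one _ i]
  · simp [compression]
  · intro l j hj
    simp [Function.update_of_ne hj, hon]

theorem integrable_eval_mul_eval_projectionDPP [IsFiniteMeasure μ] (hφm : ∀ k, Measurable (φ k))
    (hφ : ∀ k, MemLp (φ k) ⊤ μ) {f : X → ℝ} (hf : MemLp f ⊤ μ) (i j : Fin p) :
    Integrable (fun x : Fin p → X => f (x i) * f (x j)) (projectionDPP μ (projKernel φ) p) := by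
  by_cases hij : i = j
  · subst hij
    exact integrable_eval_projectionDPP hφm hφ (hf.mul (r := ⊤) hf) i
  · have := integrable_prod_projectionDPP hφm hφ
      (memLp_update hf (memLp_update hf (fun _ => memLp_top_one) i) j)
    simpa only [prod_update_update_one f hij] using this

/-- Off the diagonal, orthonormality reduces the determinant to a 2×2 minor. This minor vanishes for
`i = j`, so adding the `f²` term there gives one formula for both cases. -/
theorem integral_eval_mul_eval_projectionDPP [IsFiniteMeasure μ] (hφm : ∀ k, Measurable (φ k))
    (hφ : ∀ k, MemLp (φ k) ⊤ μ) (hon : ∀ k l, ∫ y, φ k y * φ l y ∂μ = if k = l then 1 else 0)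
    {f : X → ℝ} (hf : MemLp f ⊤ μ) (i j : Fin p) :
    ∫ x, f (x i) * f (x j) ∂(projectionDPP μ (projKernel φ) p)
      = (p.factorial : ℝ)⁻¹ * ∑ σ : Equiv.Perm (Fin p),
        (compression μ φ f (σ i) (σ i) * compression μ φ f (σ j) (σ j)
          - compression μ φ f (σ i) (σ j) ^ 2
          + if i = j then compression μ φ (fun y => f y * f y) (σ i) (σ i) else 0) := by
  by_cases hij : i = j
  · subst hij
    rw [integral_eval_projectionDPP hφm hφ hon (f := fun y => f y * f y) (hf.mul (r := ⊤) hf) i]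
    congr 1
    refine Finset.sum_congr rfl fun σ _ => ?_
    rw [if_pos rfl]
    ring
  · have := integral_prod_projectionDPP hφm hφ
      (memLp_update hf (memLp_update hf (fun _ => memLp_top_one) i) j)
    simp only [prod_update_update_one f hij] at this
    rw [this]
    congr 1
    refine Finset.sum_congr rfl fun σ _ => ?_
    rw [det_eq_of_cols_eq_one _ hij]
    · simp only [Matrix.of_apply, if_neg hij, Function.update_of_ne hij, Function.update_self]
      change compression μ φ f _ _ * compression μ φ f _ _
        - compression μ φ f _ _ * compression μ φ f _ _ = _
      rw [compression_comm f (σ j) (σ i)]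
      ring
    · intro l m hmi hmj
      simp [Function.update_of_ne hmi, Function.update_of_ne hmj, hon]

theorem factorial_inv_mul_sum_perm (c : ℝ) :
    (p.factorial : ℝ)⁻¹ * ∑ _σ : Equiv.Perm (Fin p), c = c := by
  rw [Finset.sum_const, Finset.card_univ, Fintype.card_perm, Fintype.card_fin, nsmul_eq_mul,
    inv_mul_cancel_left₀]
  exact_mod_cast p.factorial_ne_zero

/-- The variance of the linear statistic `∑ f(x_i)` under a projection DPP, as the squared
Hilbert–Schmidt norm of the off-diagonal block of multiplication by `f`. -/
noncomputable def blockVariance (μ : Measure X) (φ : Fin p → X → ℝ) (f : X → ℝ) : ℝ :=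
  ∑ k, compression μ φ (fun y => f y * f y) k k - ∑ k, ∑ l, compression μ φ f k l ^ 2

theorem aestronglyMeasurable_eval_projectionDPP [IsFiniteMeasure μ] {E : Type*}
    [TopologicalSpace E] {f : X → E} (hf : AEStronglyMeasurable f μ) (i : Fin p) :
    AEStronglyMeasurable (fun x : Fin p → X => f (x i)) (projectionDPP μ (projKernel φ) p) :=
  (hf.comp_quasiMeasurePreserving (Measure.quasiMeasurePreserving_eval (fun _ => μ) i)).mono_ac
    (withDensity_absolutelyContinuous _ _)

theorem variance_sum_projectionDPP [IsFiniteMeasure μ] (hφm : ∀ k, Measurable (φ k))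
    (hφ : ∀ k, MemLp (φ k) ⊤ μ) (hon : ∀ k l, ∫ y, φ k y * φ l y ∂μ = if k = l then 1 else 0)
    [IsProbabilityMeasure (projectionDPP μ (projKernel φ) p)]
    {f : X → ℝ} (hf : MemLp f ⊤ μ) :
    MemLp (fun x : Fin p → X => ∑ i, f (x i)) 2 (projectionDPP μ (projKernel φ) p) ∧
    Var[fun x : Fin p → X => ∑ i, f (x i); projectionDPP μ (projKernel φ) p]
      = blockVariance μ φ f := by
  have hint := integrable_eval_mul_eval_projectionDPP hφm hφ hf
  have hsq : ∀ x : Fin p → X, (∑ i, f (x i)) ^ 2 = ∑ i, ∑ j, f (x i) * f (x j) := fun x => by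
    rw [sq, Finset.sum_mul_sum]
  have hmem : MemLp (fun x : Fin p → X => ∑ i, f (x i)) 2
      (projectionDPP μ (projKernel φ) p) := by
    rw [memLp_two_iff_integrable_sq]
    · simp_rw [hsq]
      exact integrable_finsetSum _ fun i _ => integrable_finsetSum _ fun j _ => hint i j
    · exact Finset.aestronglyMeasurable_fun_sum _ fun i _ =>
        aestronglyMeasurable_eval_projectionDPP hf.1 i
  refine ⟨hmem, ?_⟩
  have hmean : ∫ x, ∑ i, f (x i) ∂(projectionDPP μ (projKernel φ) p)
      = ∑ k, compression μ φ f k k := by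
    rw [integral_finsetSum _ fun i _ => integrable_eval_projectionDPP hφm hφ hf i]
    simp_rw [integral_eval_projectionDPP hφm hφ hon hf]
    rw [← Finset.mul_sum, Finset.sum_comm]
    simp_rw [fun σ : Equiv.Perm (Fin p) => Equiv.sum_comp σ fun k => compression μ φ f k k]
    exact factorial_inv_mul_sum_perm _
  have hsecond : ∫ x, (∑ i, f (x i)) ^ 2 ∂(projectionDPP μ (projKernel φ) p)
      = ∑ k, ∑ l, (compression μ φ f k k * compression μ φ f l l - compression μ φ f k l ^ 2
          + if k = l then compression μ φ (fun y => f y * f y) k k else 0) := by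
    simp_rw [hsq]
    rw [integral_finsetSum _ fun i _ => integrable_finsetSum _ fun j _ => hint i j]
    simp_rw [fun i => integral_finsetSum Finset.univ fun j _ => hint i j,
      integral_eval_mul_eval_projectionDPP hφm hφ hon hf]
    simp_rw [← Finset.mul_sum]
    conv_lhs =>
      enter [2, 2, i]
      rw [Finset.sum_comm]
    rw [Finset.sum_comm]
    refine Eq.trans (congrArg _ ?_) (factorial_inv_mul_sum_perm (p := p) _)
    refine Finset.sum_congr rfl fun σ _ => ?_
    -- Relabelling both indices by `σ` makes every summand independent of `σ`, so the average over
    -- permutations is trivial.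
    symm
    rw [← Equiv.sum_comp σ]
    refine Finset.sum_congr rfl fun i _ => ?_
    rw [← Equiv.sum_comp σ]
    simp
  rw [variance_eq_sub hmem]
  simp only [Pi.pow_apply]
  rw [hsecond, hmean, blockVariance]
  simp_rw [Finset.sum_add_distrib, Finset.sum_sub_distrib, ← Finset.mul_sum, ← Finset.sum_mul]
  simp
  ring

end ProjectionDPPVariance

/-! ### The variance as a double integral, and comparison of statistics -/

section DoubleIntegral

variable {X : Type*} [MeasurableSpace X] {μ : Measure X} {p : ℕ} {φ : Fin p → X → ℝ}

/-- Expanding both squares separates the variables; orthonormality collapses the two `f²` terms to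
the diagonal, and the cross term gives the squared compression entries. -/
theorem integrable_and_integral_sq_sub_mul_projKernel_sq [IsFiniteMeasure μ]
    (hφ : ∀ k, MemLp (φ k) ⊤ μ) (hon : ∀ k l, ∫ y, φ k y * φ l y ∂μ = if k = l then 1 else 0)
    {f : X → ℝ} (hf : MemLp f ⊤ μ) :
    Integrable (fun z : X × X => (f z.1 - f z.2) ^ 2 * projKernel φ z.1 z.2 ^ 2) (μ.prod μ) ∧
    ∫ z, (f z.1 - f z.2) ^ 2 * projKernel φ z.1 z.2 ^ 2 ∂(μ.prod μ) = 2 * blockVariance μ φ f := by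
  have hexp : ∀ z : X × X, (f z.1 - f z.2) ^ 2 * projKernel φ z.1 z.2 ^ 2
      = ∑ k, ∑ l, ((f z.1 * f z.1 * (φ k z.1 * φ l z.1)) * (φ k z.2 * φ l z.2)
        + (φ k z.1 * φ l z.1) * (f z.2 * f z.2 * (φ k z.2 * φ l z.2))
        - 2 * ((f z.1 * (φ k z.1 * φ l z.1)) * (f z.2 * (φ k z.2 * φ l z.2)))) := fun z => by
    rw [projKernel, sq (∑ k, _), Finset.sum_mul_sum, Finset.mul_sum]
    refine Finset.sum_congr rfl fun k _ => ?_
    rw [Finset.mul_sum]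
    exact Finset.sum_congr rfl fun l _ => by ring
  have h0 : ∀ k l, Integrable (fun y => φ k y * φ l y) μ := fun k l =>
    memLp_top_integrable ((hφ l).mul (r := ⊤) (hφ k))
  have h1 : ∀ k l, Integrable (fun y => f y * (φ k y * φ l y)) μ := fun k l =>
    memLp_top_integrable (((hφ l).mul (r := ⊤) (hφ k)).mul (r := ⊤) hf)
  have h2 : ∀ k l, Integrable (fun y => f y * f y * (φ k y * φ l y)) μ := fun k l =>
    memLp_top_integrable (((hφ l).mul (r := ⊤) (hφ k)).mul (r := ⊤) (hf.mul (r := ⊤) hf))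
  have i1 := fun k l => (h2 k l).mul_prod (h0 k l)
  have i2 := fun k l => (h0 k l).mul_prod (h2 k l)
  have i3 := fun k l => ((h1 k l).mul_prod (h1 k l)).const_mul 2
  have i4 : ∀ k l, Integrable (fun z : X × X =>
      (f z.1 * f z.1 * (φ k z.1 * φ l z.1)) * (φ k z.2 * φ l z.2)
        + (φ k z.1 * φ l z.1) * (f z.2 * f z.2 * (φ k z.2 * φ l z.2))
        - 2 * ((f z.1 * (φ k z.1 * φ l z.1)) * (f z.2 * (φ k z.2 * φ l z.2)))) (μ.prod μ) :=
    fun k l => ((i1 k l).add (i2 k l)).sub (i3 k l)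
  have i5 := fun k => integrable_finsetSum Finset.univ fun l _ => i4 k l
  simp_rw [hexp]
  refine ⟨integrable_finsetSum _ fun k _ => i5 k, ?_⟩
  rw [integral_finsetSum _ fun k _ => i5 k]
  have hterm : ∀ k l, ∫ z : X × X, ((f z.1 * f z.1 * (φ k z.1 * φ l z.1)) * (φ k z.2 * φ l z.2)
        + (φ k z.1 * φ l z.1) * (f z.2 * f z.2 * (φ k z.2 * φ l z.2))
        - 2 * ((f z.1 * (φ k z.1 * φ l z.1)) * (f z.2 * (φ k z.2 * φ l z.2)))) ∂(μ.prod μ)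
      = 2 * ((if k = l then compression μ φ (fun y => f y * f y) k k else 0)
        - compression μ φ f k l ^ 2) := by
    intro k l
    refine (integral_sub ((i1 k l).add (i2 k l)) (i3 k l)).trans
      ((congrArg (· - _) (integral_add (i1 k l) (i2 k l))).trans ?_)
    rw [integral_const_mul, integral_prod_mul (fun y => f y * f y * (φ k y * φ l y))
        (fun y => φ k y * φ l y), integral_prod_mul (fun y => φ k y * φ l y)
        (fun y => f y * f y * (φ k y * φ l y)), integral_prod_mul (fun y => f y * (φ k y * φ l y))
        (fun y => f y * (φ k y * φ l y)), hon]
    simp only [compression]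
    split_ifs with h
    · subst h; ring
    · ring
  rw [Finset.sum_congr rfl fun k _ => integral_finsetSum Finset.univ fun l _ => i4 k l]
  rw [Finset.sum_congr rfl fun k _ => Finset.sum_congr rfl fun l _ => hterm k l]
  simp_rw [← Finset.mul_sum, Finset.sum_sub_distrib, blockVariance]
  simp

/-- The weight `K²` is nonnegative, so a pointwise comparison of squared increments integrates to a
comparison of variances. -/
theorem sum_blockVariance_le [IsFiniteMeasure μ] (hφ : ∀ k, MemLp (φ k) ⊤ μ)
    (hon : ∀ k l, ∫ y, φ k y * φ l y ∂μ = if k = l then 1 else 0) {m d : ℕ}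
    {F : Fin m → X → ℝ} (hF : ∀ c, MemLp (F c) ⊤ μ) {g : Fin d → X → ℝ}
    (hg : ∀ i, MemLp (g i) ⊤ μ) (L : ℝ)
    (hle : ∀ᵐ z ∂(μ.prod μ), ∑ c, (F c z.1 - F c z.2) ^ 2 ≤ L * ∑ i, (g i z.1 - g i z.2) ^ 2) :
    ∑ c, blockVariance μ φ (F c) ≤ L * ∑ i, blockVariance μ φ (g i) := by
  have hFi := fun c => integrable_and_integral_sq_sub_mul_projKernel_sq hφ hon (hF c)
  have hgi := fun i => integrable_and_integral_sq_sub_mul_projKernel_sq hφ hon (hg i)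
  have key : ∫ z, ∑ c, (F c z.1 - F c z.2) ^ 2 * projKernel φ z.1 z.2 ^ 2 ∂(μ.prod μ)
      ≤ ∫ z, L * ∑ i, (g i z.1 - g i z.2) ^ 2 * projKernel φ z.1 z.2 ^ 2 ∂(μ.prod μ) := by
    refine integral_mono_ae (integrable_finsetSum _ fun c _ => (hFi c).1)
      ((integrable_finsetSum _ fun i _ => (hgi i).1).const_mul _) ?_
    filter_upwards [hle] with z hz
    simp_rw [← Finset.sum_mul, ← mul_assoc]
    exact mul_le_mul_of_nonneg_right hz (sq_nonneg _)
  rw [integral_finsetSum _ fun c _ => (hFi c).1, integral_const_mul,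
    integral_finsetSum _ fun i _ => (hgi i).1, Finset.sum_congr rfl fun c _ => (hFi c).2,
    Finset.sum_congr rfl fun i _ => (hgi i).2, ← Finset.mul_sum, ← Finset.mul_sum] at key
  linarith

theorem vectorVariance_eq_sum_variance {S : Type*} [MeasurableSpace S] {ν : Measure S}
    [IsProbabilityMeasure ν] {m : ℕ} {Y : S → EuclideanSpace ℝ (Fin m)}
    (hY : ∀ c, MemLp (fun a => Y a c) 2 ν) :
    vectorVariance Y ν = ENNReal.ofReal (∑ c, Var[fun a => Y a c; ν]) := by
  have hmean : ∀ c, (∫ b, Y b ∂ν) c = ∫ b, Y b c ∂ν :=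
    eval_integral_piLp fun i => (hY i).integrable one_le_two
  have hcoord : ∀ a, ‖Y a - ∫ b, Y b ∂ν‖ₑ ^ 2 = ∑ c, ‖Y a c - ∫ b, Y b c ∂ν‖ₑ ^ 2 := by
    intro a
    simp_rw [← hmean, ← ofReal_norm, ← ENNReal.ofReal_pow (norm_nonneg _),
      EuclideanSpace.norm_sq_eq]
    rw [ENNReal.ofReal_sum_of_nonneg fun _ _ => by positivity]
    rfl
  simp_rw [vectorVariance, hcoord]
  have hmeas : ∀ c, AEMeasurable (fun a => ‖Y a c - ∫ b, Y b c ∂ν‖ₑ ^ 2) ν := fun c =>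
    ((hY c).1.sub aestronglyMeasurable_const).enorm.pow_const 2
  rw [lintegral_finsetSum' _ fun c _ => hmeas c,
    ENNReal.ofReal_sum_of_nonneg fun _ _ => variance_nonneg _ _]
  exact Finset.sum_congr rfl fun c _ => (hY c).ofReal_variance_eq.symm

theorem vectorVariance_smul_sum_projectionDPP [IsFiniteMeasure μ] (hφm : ∀ k, Measurable (φ k))
    (hφ : ∀ k, MemLp (φ k) ⊤ μ) (hon : ∀ k l, ∫ y, φ k y * φ l y ∂μ = if k = l then 1 else 0)
    [IsProbabilityMeasure (projectionDPP μ (projKernel φ) p)] {m : ℕ}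
    {F : X → EuclideanSpace ℝ (Fin m)} (hF : ∀ c, MemLp (fun x => F x c) ⊤ μ) (a : ℝ) :
    vectorVariance (fun x : Fin p → X => a • ∑ j, F (x j)) (projectionDPP μ (projKernel φ) p)
      = ENNReal.ofReal (a ^ 2 * ∑ c, blockVariance μ φ fun x => F x c) := by
  have hcoord : ∀ c, (fun x : Fin p → X => (a • ∑ j, F (x j)) c)
      = fun x => a * ∑ j, F (x j) c := fun c => by
    ext x
    simp
  have hv := fun c => variance_sum_projectionDPP hφm hφ hon (hF c)
  rw [vectorVariance_eq_sum_variance]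
  · simp_rw [hcoord, variance_const_mul, fun c => (hv c).2, ← Finset.mul_sum]
  · intro c
    rw [hcoord]
    exact (hv c).1.const_mul a

end DoubleIntegral

/-! ### A rank bound for Hilbert–Schmidt norms -/

/-- A contraction that vanishes on the kernel of a map to `ℝ^ι` has squared Hilbert–Schmidt norm
at most `|ι|`. -/
theorem sum_sq_norm_le_card_of_ker_le {n ι H : Type*} [Fintype n] [DecidableEq n] [Fintype ι]
    [NormedAddCommGroup H] [InnerProductSpace ℝ H] (R : EuclideanSpace ℝ n →ₗ[ℝ] H)
    (hR : ∀ u, ‖R u‖ ≤ ‖u‖) (D : EuclideanSpace ℝ n →ₗ[ℝ] (ι → ℝ))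
    (hD : ∀ u, D u = 0 → R u = 0) :
    ∑ k, ‖R (EuclideanSpace.single k 1)‖ ^ 2 ≤ Fintype.card ι := by
  set K := LinearMap.ker D
  let b := stdOrthonormalBasis ℝ Kᗮ
  -- `R` sees only the projection onto `Kᗮ`. Summing this bound over the standard basis gives the
  -- trace of that projection, which is the rank of `D`.
  have hbound : ∀ u, ‖R u‖ ^ 2 ≤ ∑ j, inner ℝ (b j : EuclideanSpace ℝ n) u ^ 2 := by
    intro u
    have h1 : R u = R (Kᗮ.starProjection u) := by
      have h2 : R (K.starProjection u) = 0 := hD _ (K.starProjection_apply_mem u)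
      conv_lhs => rw [← K.starProjection_add_starProjection_orthogonal u]
      rw [map_add, h2, zero_add]
    rw [h1]
    calc ‖R (Kᗮ.starProjection u)‖ ^ 2 ≤ ‖Kᗮ.starProjection u‖ ^ 2 := by
          gcongr
          exact hR _
      _ = ‖Kᗮ.orthogonalProjectionOnto u‖ ^ 2 := rfl
      _ = ∑ j, inner ℝ (b j : EuclideanSpace ℝ n) u ^ 2 := by
          rw [← b.sum_sq_norm_inner_right]
          refine Finset.sum_congr rfl fun j _ => ?_
          rw [Submodule.inner_orthogonalProjectionOnto_eq_of_mem_left, Real.norm_eq_abs, sq_abs]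
  calc ∑ k, ‖R (EuclideanSpace.single k 1)‖ ^ 2
      ≤ ∑ k, ∑ j, inner ℝ (b j : EuclideanSpace ℝ n) (EuclideanSpace.single k 1) ^ 2 :=
        Finset.sum_le_sum fun k _ => hbound _
    _ = ∑ j, ‖(b j : EuclideanSpace ℝ n)‖ ^ 2 := by
        rw [Finset.sum_comm]
        refine Finset.sum_congr rfl fun j _ => ?_
        rw [EuclideanSpace.norm_sq_eq]
        refine Finset.sum_congr rfl fun k _ => ?_
        simp [EuclideanSpace.inner_single_right]
    _ = Module.finrank ℝ Kᗮ := by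
        have : ∀ j, ‖(b j : EuclideanSpace ℝ n)‖ = 1 := fun j => b.orthonormal.1 j
        simp [this]
    _ ≤ Fintype.card ι := by
        have h1 := K.finrank_add_finrank_orthogonal
        have h2 := LinearMap.finrank_range_add_finrank_ker D
        have h3 := (LinearMap.range D).finrank_le
        rw [Module.finrank_fintype_fun_eq_card] at h3
        have h4 : Module.finrank ℝ Kᗮ = Module.finrank ℝ (LinearMap.range D) :=
          Nat.add_left_cancel (h1.trans (h2.symm.trans (Nat.add_comm _ _)))
        exact_mod_cast h4.le.trans h3

/-- The component of `y` orthogonal to an orthonormal family. -/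
noncomputable def orthoComponent {n H : Type*} [Fintype n] [NormedAddCommGroup H]
    [InnerProductSpace ℝ H] (v : n → H) : H →ₗ[ℝ] H :=
  LinearMap.id - ∑ l, (innerₛₗ ℝ (v l)).smulRight (v l)

section OrthoComponent

variable {n H : Type*} [Fintype n] [NormedAddCommGroup H] [InnerProductSpace ℝ H] {v : n → H}

theorem orthoComponent_apply (v : n → H) (y : H) :
    orthoComponent v y = y - ∑ l, inner ℝ (v l) y • v l := by
  simp [orthoComponent]

theorem norm_sq_orthoComponent (hv : Orthonormal ℝ v) (y : H) :
    ‖orthoComponent v y‖ ^ 2 = ‖y‖ ^ 2 - ∑ l, inner ℝ (v l) y ^ 2 := by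
  rw [orthoComponent_apply, norm_sub_sq_real, ← real_inner_self_eq_norm_sq (∑ l, _),
    hv.inner_sum, inner_sum]
  simp_rw [inner_smul_right, fun l => real_inner_comm (v l) y, conj_trivial, ← sq]
  ring

theorem norm_orthoComponent_le (hv : Orthonormal ℝ v) (y : H) : ‖orthoComponent v y‖ ≤ ‖y‖ := by
  rw [← sq_le_sq₀ (norm_nonneg _) (norm_nonneg _), norm_sq_orthoComponent hv]
  have : 0 ≤ ∑ l, inner ℝ (v l) y ^ 2 := Finset.sum_nonneg fun _ _ => sq_nonneg _
  linarith

theorem orthoComponent_eq_zero_of_mem_span [DecidableEq n] (hv : Orthonormal ℝ v) {y : H}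
    (hy : y ∈ Submodule.span ℝ (Set.range v)) : orthoComponent v y = 0 := by
  have hle : Submodule.span ℝ (Set.range v) ≤ LinearMap.ker (orthoComponent v) := by
    rw [Submodule.span_le]
    rintro _ ⟨k, rfl⟩
    simp [orthoComponent_apply, orthonormal_iff_ite.mp hv]
  exact hle hy

theorem Orthonormal.norm_sum_smul [DecidableEq n] (hv : Orthonormal ℝ v) (u : EuclideanSpace ℝ n) :
    ‖∑ k, u k • v k‖ = ‖u‖ := by
  rw [← sq_eq_sq₀ (norm_nonneg _) (norm_nonneg _), ← real_inner_self_eq_norm_sq, hv.inner_sum,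
    EuclideanSpace.norm_sq_eq]
  simp [sq]

end OrthoComponent

/-! ### Orthonormal polynomials of a measure on the cube -/

section OrthoPoly

variable {d : ℕ} {μ : Measure (EuclideanSpace ℝ (Fin d))}
  {grade : (Fin d → ℕ) → ℕ}

theorem continuous_evalAt (P : MvPolynomial (Fin d) ℝ) :
    Continuous fun x : EuclideanSpace ℝ (Fin d) => evalAt x P := by
  unfold evalAt
  exact (MvPolynomial.continuous_eval P).comp (by fun_prop)

theorem measurable_evalAt (P : MvPolynomial (Fin d) ℝ) :
    Measurable fun x : EuclideanSpace ℝ (Fin d) => evalAt x P :=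
  (continuous_evalAt P).measurable

theorem evalAt_X_mul (x : EuclideanSpace ℝ (Fin d)) (i : Fin d) (P : MvPolynomial (Fin d) ℝ) :
    evalAt x (MvPolynomial.X i * P) = x i * evalAt x P := by
  simp [evalAt]

theorem memLp_top_coord (hμ : ∀ᵐ x ∂μ, x ∈ cube d) (i : Fin d) :
    MemLp (fun x : EuclideanSpace ℝ (Fin d) => x i) ⊤ μ := by
  refine memLp_top_of_bound (by fun_prop) 1 ?_
  filter_upwards [hμ] with x hx
  exact abs_le.mpr (hx i)

theorem memLp_top_evalAt [IsFiniteMeasure μ] (hμ : ∀ᵐ x ∂μ, x ∈ cube d)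
    (P : MvPolynomial (Fin d) ℝ) : MemLp (fun x => evalAt x P) ⊤ μ := by
  induction P using MvPolynomial.induction_on with
  | C a => simpa [evalAt] using memLp_top_const a
  | add P Q hP hQ =>
    simp only [evalAt, map_add] at hP hQ ⊢
    exact hP.add hQ
  | mul_X P i hP =>
    simp only [evalAt, map_mul, MvPolynomial.eval_X] at hP ⊢
    exact (memLp_top_coord hμ i).mul (r := ⊤) hP

/-- Polynomials as elements of `L²(μ)`. -/
noncomputable def polyToL2 [IsFiniteMeasure μ] (hμ : ∀ᵐ x ∂μ, x ∈ cube d) :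
    MvPolynomial (Fin d) ℝ →ₗ[ℝ] Lp ℝ 2 μ where
  toFun P := ((memLp_top_evalAt hμ P).mono_exponent le_top).toLp _
  map_add' P Q := by
    rw [← MemLp.toLp_add]
    congr 1
    ext x
    simp [evalAt]
  map_smul' c P := by
    rw [RingHom.id_apply, ← MemLp.toLp_const_smul]
    congr 1
    ext x
    simp [evalAt, MvPolynomial.smul_eval]

theorem inner_polyToL2 [IsFiniteMeasure μ] (hμ : ∀ᵐ x ∂μ, x ∈ cube d)
    (P Q : MvPolynomial (Fin d) ℝ) :
    inner ℝ (polyToL2 hμ P) (polyToL2 hμ Q) = polyInner μ P Q := by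
  rw [L2.inner_def, polyInner]
  refine integral_congr_ae ?_
  filter_upwards [MemLp.coeFn_toLp ((memLp_top_evalAt hμ P).mono_exponent (p := 2) le_top),
    MemLp.coeFn_toLp ((memLp_top_evalAt hμ Q).mono_exponent (p := 2) le_top)] with x hP hQ
  have hP' : polyToL2 hμ P x = evalAt x P := hP
  have hQ' : polyToL2 hμ Q x = evalAt x Q := hQ
  rw [hP', hQ']
  simp [mul_comm]

/-- Since `|x_i| ≤ 1` on the cube, multiplication is a contraction, as the rank bound requires. -/
theorem norm_polyToL2_X_mul_le [IsFiniteMeasure μ] (hμ : ∀ᵐ x ∂μ, x ∈ cube d) (i : Fin d)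
    (P : MvPolynomial (Fin d) ℝ) :
    ‖polyToL2 hμ (MvPolynomial.X i * P)‖ ≤ ‖polyToL2 hμ P‖ := by
  rw [← sq_le_sq₀ (norm_nonneg _) (norm_nonneg _), ← real_inner_self_eq_norm_sq,
    ← real_inner_self_eq_norm_sq, inner_polyToL2, inner_polyToL2]
  have hint : ∀ Q : MvPolynomial (Fin d) ℝ, Integrable (fun x => evalAt x Q * evalAt x Q) μ :=
    fun Q => memLp_top_integrable ((memLp_top_evalAt hμ Q).mul (r := ⊤) (memLp_top_evalAt hμ Q))
  refine integral_mono_ae (hint _) (hint _) ?_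
  filter_upwards [hμ] with x hx
  simp only [evalAt_X_mul]
  have h1 : x i * x i ≤ 1 := by nlinarith [(hx i).1, (hx i).2]
  nlinarith [mul_self_nonneg (evalAt x P)]

/-- The unnormalized residual of the Gram–Schmidt algorithm. -/
noncomputable def gramSchmidtResidual (grade : (Fin d → ℕ) → ℕ)
    (μ : Measure (EuclideanSpace ℝ (Fin d))) (n : ℕ) : MvPolynomial (Fin d) ℝ :=
  orderedMonomial grade n -
    ∑ k : Fin n, polyInner μ (orderedMonomial grade n) (orthoPoly grade μ k) • orthoPoly grade μ k

theorem orthoPoly_eq (n : ℕ) : orthoPoly grade μ n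
    = (Real.sqrt (polyInner μ (gramSchmidtResidual grade μ n) (gramSchmidtResidual grade μ n)))⁻¹
      • gramSchmidtResidual grade μ n := by
  rw [orthoPoly]
  rfl

theorem inner_polyToL2_orthoPoly [IsFiniteMeasure μ] (hμ : ∀ᵐ x ∂μ, x ∈ cube d) {p : ℕ}
    (hne : ∀ k < p, orthoPoly grade μ k ≠ 0) : ∀ n < p,
    (∀ k < n, inner ℝ (polyToL2 hμ (orthoPoly grade μ n)) (polyToL2 hμ (orthoPoly grade μ k)) = 0)
      ∧ inner ℝ (polyToL2 hμ (orthoPoly grade μ n)) (polyToL2 hμ (orthoPoly grade μ n)) = 1 := by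
  intro n
  induction n using Nat.strong_induction_on with
  | _ n ih =>
    intro hn
    have hort : ∀ j < n, ∀ k < n, inner ℝ (polyToL2 hμ (orthoPoly grade μ j))
        (polyToL2 hμ (orthoPoly grade μ k)) = if j = k then 1 else 0 := by
      intro j hj k hk
      rcases lt_trichotomy j k with h | h | h
      · rw [if_neg h.ne, real_inner_comm]
        exact (ih k hk (hk.trans hn)).1 j h
      · subst h
        rw [if_pos rfl]
        exact (ih j hj (hj.trans hn)).2
      · rw [if_neg h.ne']
        exact (ih j hj (hj.trans hn)).1 k h
    -- With the convention `0⁻¹ = 0`, a null residual would make the normalized polynomial zero.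
    have hsqrt : Real.sqrt (polyInner μ (gramSchmidtResidual grade μ n)
        (gramSchmidtResidual grade μ n)) ≠ 0 := by
      intro h0
      refine hne n hn ?_
      rw [orthoPoly_eq, h0, inv_zero, zero_smul]
    constructor
    · intro k hk
      suffices hres : inner ℝ (polyToL2 hμ (gramSchmidtResidual grade μ n))
          (polyToL2 hμ (orthoPoly grade μ k)) = 0 by
        rw [orthoPoly_eq n, map_smul, real_inner_smul_left, hres, mul_zero]
      rw [gramSchmidtResidual, map_sub, map_sum, inner_sub_left, sum_inner]
      simp_rw [map_smul, real_inner_smul_left, ← inner_polyToL2 hμ]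
      rw [Finset.sum_eq_single (⟨k, hk⟩ : Fin n)]
      · rw [hort k hk k hk, if_pos rfl]
        simp
      · intro j _ hj
        rw [hort j j.2 k hk, if_neg (fun h => hj (Fin.ext h)), mul_zero]
      · exact fun h => absurd (Finset.mem_univ _) h
    · rw [orthoPoly_eq n, map_smul, real_inner_smul_left, real_inner_smul_right, inner_polyToL2]
      have hnn : 0 ≤ polyInner μ (gramSchmidtResidual grade μ n)
          (gramSchmidtResidual grade μ n) := by
        rw [← inner_polyToL2 hμ]
        exact real_inner_self_nonneg
      nth_rewrite 3 [← Real.mul_self_sqrt hnn]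
      field_simp

theorem orthonormal_orthoPoly [IsFiniteMeasure μ] (hμ : ∀ᵐ x ∂μ, x ∈ cube d) {p : ℕ}
    (hne : ∀ k < p, orthoPoly grade μ k ≠ 0) :
    Orthonormal ℝ fun k : Fin p => polyToL2 hμ (orthoPoly grade μ k) := by
  have h := inner_polyToL2_orthoPoly hμ hne
  rw [orthonormal_iff_ite]
  intro j k
  rcases lt_trichotomy j k with hjk | hjk | hjk
  · rw [if_neg hjk.ne, real_inner_comm]
    exact (h k k.2).1 j hjk
  · subst hjk
    rw [if_pos rfl]
    exact (h j j.2).2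
  · rw [if_neg hjk.ne']
    exact (h j j.2).1 k hjk

theorem orderedMonomial_mem_span [IsFiniteMeasure μ] {p : ℕ}
    (hne : ∀ k < p, orthoPoly grade μ k ≠ 0) {n : ℕ} (hn : n < p) :
    orderedMonomial grade n
      ∈ Submodule.span ℝ (Set.range fun k : Fin p => orthoPoly grade μ k) := by
  have hmem : ∀ k < p, orthoPoly grade μ k
      ∈ Submodule.span ℝ (Set.range fun k : Fin p => orthoPoly grade μ k) := fun k hk =>
    Submodule.subset_span ⟨⟨k, hk⟩, rfl⟩
  have hres : gramSchmidtResidual grade μ n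
      ∈ Submodule.span ℝ (Set.range fun k : Fin p => orthoPoly grade μ k) := by
    have h0 : Real.sqrt (polyInner μ (gramSchmidtResidual grade μ n)
        (gramSchmidtResidual grade μ n)) ≠ 0 := by
      intro h0
      refine hne n hn ?_
      rw [orthoPoly_eq, h0, inv_zero, zero_smul]
    have := Submodule.smul_mem _ (Real.sqrt (polyInner μ (gramSchmidtResidual grade μ n)
        (gramSchmidtResidual grade μ n))) (hmem n hn)
    rwa [orthoPoly_eq n, smul_inv_smul₀ h0] at this
  have := Submodule.add_mem _ hres (Submodule.sum_mem _ (t := Finset.univ) fun (k : Fin n) _ =>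
    Submodule.smul_mem _ (polyInner μ (orderedMonomial grade n) (orthoPoly grade μ k))
      (hmem k (k.2.trans hn)))
  rwa [gramSchmidtResidual, sub_add_cancel] at this

/-- The exponents of rank less than `p`. -/
def initialExponents (grade : (Fin d → ℕ) → ℕ) (p : ℕ) : Set (Fin d →₀ ℕ) :=
  {s | gradedLexRank grade s < p}

theorem orderedMonomial_eq (n : ℕ) : orderedMonomial grade n
    = MvPolynomial.monomial (Finsupp.equivFunOnFinite.symm (gradedLexEnum grade n)) 1 := by
  rw [MvPolynomial.monomial_eq, orderedMonomial, MvPolynomial.C_1, one_mul,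
    Finsupp.prod_fintype _ _ fun i => pow_zero _]
  rfl

/-- Gram–Schmidt is triangular and can be inverted when no residual is null. The inclusion is
between spaces of polynomials, so injectivity of `polyToL2` plays no role. -/
theorem restrictSupport_le_span [IsFiniteMeasure μ]
    (hrank : Function.Bijective (gradedLexRank grade)) {p : ℕ}
    (hne : ∀ k < p, orthoPoly grade μ k ≠ 0) :
    MvPolynomial.restrictSupport ℝ (initialExponents grade p)
      ≤ Submodule.span ℝ (Set.range fun k : Fin p => orthoPoly grade μ k) := by
  rw [MvPolynomial.restrictSupport_eq_span, Submodule.span_le]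
  rintro _ ⟨s, hs, rfl⟩
  have := orderedMonomial_mem_span hne (n := gradedLexRank grade s) hs
  rw [orderedMonomial_eq, gradedLexEnum, Function.leftInverse_invFun hrank.1 s] at this
  have hs' : Finsupp.equivFunOnFinite.symm (s : Fin d → ℕ) = s := by
    ext
    simp
  rwa [hs'] at this

theorem orthoPoly_mem_restrictSupport (hrank : Function.Bijective (gradedLexRank grade)) {p : ℕ} :
    ∀ n < p, orthoPoly grade μ n ∈ MvPolynomial.restrictSupport ℝ (initialExponents grade p) := by
  intro n
  induction n using Nat.strong_induction_on with
  | _ n ih =>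
    intro hn
    rw [orthoPoly_eq]
    refine Submodule.smul_mem _ _ (Submodule.sub_mem _ ?_ (Submodule.sum_mem _ fun k _ =>
      Submodule.smul_mem _ _ (ih k k.2 (k.2.trans hn))))
    rw [orderedMonomial_eq, MvPolynomial.monomial_mem_restrictSupport]
    left
    change gradedLexRank grade (gradedLexEnum grade n) < p
    rwa [gradedLexEnum, Function.rightInverse_invFun hrank.2 n]

/-- The exponents of rank less than `p` that leave this set when the `i`-th exponent is
increased by one. -/
def boundaryExponents (grade : (Fin d → ℕ) → ℕ) (p : ℕ) (i : Fin d) : Set (Fin d →₀ ℕ) :=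
  {s | s ∈ initialExponents grade p ∧ s + Finsupp.single i 1 ∉ initialExponents grade p}

theorem compression_coord_eq [IsFiniteMeasure μ] (hμ : ∀ᵐ x ∂μ, x ∈ cube d) {p : ℕ} (i : Fin d)
    (k l : Fin p) :
    compression μ (fun (k : Fin p) x => evalAt x (orthoPoly grade μ k)) (fun x => x i) k l
      = inner ℝ (polyToL2 hμ (orthoPoly grade μ l))
        (polyToL2 hμ (MvPolynomial.X i * orthoPoly grade μ k)) := by
  rw [inner_polyToL2, polyInner, compression]
  simp_rw [evalAt_X_mul]
  congr 1
  ext x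
  ring

theorem compression_coord_sq_eq [IsFiniteMeasure μ] (hμ : ∀ᵐ x ∂μ, x ∈ cube d) {p : ℕ} (i : Fin d)
    (k : Fin p) :
    compression μ (fun (k : Fin p) x => evalAt x (orthoPoly grade μ k)) (fun x => x i * x i) k k
      = ‖polyToL2 hμ (MvPolynomial.X i * orthoPoly grade μ k)‖ ^ 2 := by
  rw [← real_inner_self_eq_norm_sq, inner_polyToL2, polyInner, compression]
  simp_rw [evalAt_X_mul]
  congr 1
  ext x
  ring

/-- The block variance is `∑ ‖(1 - Π) x_i φ_k‖²`, with `Π` the projection onto the span. A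
polynomial in the span without boundary coefficients stays in it after multiplication by `x_i`, so
the rank bound applies. -/
theorem blockVariance_coord_le [IsFiniteMeasure μ] (hμ : ∀ᵐ x ∂μ, x ∈ cube d)
    (hrank : Function.Bijective (gradedLexRank grade)) {p : ℕ}
    (hne : ∀ k < p, orthoPoly grade μ k ≠ 0) (i : Fin d)
    (hfin : (boundaryExponents grade p i).Finite) :
    blockVariance μ (fun (k : Fin p) x => evalAt x (orthoPoly grade μ k)) (fun x => x i)
      ≤ (boundaryExponents grade p i).ncard := by
  have hon := orthonormal_orthoPoly (grade := grade) hμ hne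
  let V : EuclideanSpace ℝ (Fin p) →ₗ[ℝ] MvPolynomial (Fin d) ℝ :=
    ∑ k : Fin p, (EuclideanSpace.projₗ k).smulRight (orthoPoly grade μ k)
  have hV : ∀ u, V u = ∑ k, u k • orthoPoly grade μ k := fun u => by simp [V]
  have hVsupp : ∀ u, V u ∈ MvPolynomial.restrictSupport ℝ (initialExponents grade p) := by
    intro u
    rw [hV]
    exact Submodule.sum_mem _ fun k _ =>
      Submodule.smul_mem _ _ (orthoPoly_mem_restrictSupport hrank k k.2)
  have hVsingle : ∀ k, V (EuclideanSpace.single k 1) = orthoPoly grade μ k := fun k => by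
    rw [hV]
    simp
  let v : Fin p → Lp ℝ 2 μ := fun k => polyToL2 hμ (orthoPoly grade μ k)
  let R : EuclideanSpace ℝ (Fin p) →ₗ[ℝ] Lp ℝ 2 μ :=
    orthoComponent v ∘ₗ polyToL2 hμ ∘ₗ LinearMap.mulLeft ℝ (MvPolynomial.X i) ∘ₗ V
  have hRapp : ∀ u, R u = orthoComponent v (polyToL2 hμ (MvPolynomial.X i * V u)) := fun u => rfl
  have := hfin.fintype
  -- `D` reads off the coefficients at the boundary exponents.
  let D : EuclideanSpace ℝ (Fin p) →ₗ[ℝ] (boundaryExponents grade p i → ℝ) :=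
    LinearMap.pi fun s => MvPolynomial.lcoeff ℝ s.1 ∘ₗ V
  have hRle : ∀ u, ‖R u‖ ≤ ‖u‖ := by
    intro u
    rw [hRapp]
    refine (norm_orthoComponent_le hon _).trans ((norm_polyToL2_X_mul_le hμ i _).trans ?_)
    rw [hV, map_sum]
    simp_rw [map_smul]
    exact (Orthonormal.norm_sum_smul hon u).le
  have hRD : ∀ u, D u = 0 → R u = 0 := by
    intro u hu
    rw [hRapp]
    refine orthoComponent_eq_zero_of_mem_span hon ?_
    have hmem : MvPolynomial.X i * V u
        ∈ MvPolynomial.restrictSupport ℝ (initialExponents grade p) := by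
      rw [MvPolynomial.mem_restrictSupport_iff, MvPolynomial.support_X_mul]
      intro s hs
      simp only [Finset.coe_map, Set.mem_image, Finset.mem_coe, addLeftEmbedding_apply] at hs
      obtain ⟨t, ht, rfl⟩ := hs
      by_contra hcon
      have htb : t ∈ boundaryExponents grade p i :=
        ⟨(MvPolynomial.mem_restrictSupport_iff ℝ).mp (hVsupp u) ht, by rwa [add_comm]⟩
      have := congrFun hu ⟨t, htb⟩
      exact (MvPolynomial.mem_support_iff.mp ht) this
    have hspan := Submodule.mem_map_of_mem (f := polyToL2 hμ)
      (restrictSupport_le_span (μ := μ) hrank hne hmem)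
    rwa [Submodule.map_span, ← Set.range_comp] at hspan
  have hon' : Orthonormal ℝ v := hon
  have key := sum_sq_norm_le_card_of_ker_le R hRle D hRD
  rw [← Nat.card_eq_fintype_card, Nat.card_coe_set_eq] at key
  refine le_trans (le_of_eq ?_) key
  simp_rw [hRapp, hVsingle, norm_sq_orthoComponent hon', Finset.sum_sub_distrib, blockVariance,
    compression_coord_eq hμ, compression_coord_sq_eq hμ]
  rfl

end OrthoPoly

/-! ### Counting boundary exponents -/

section Counting

variable {d : ℕ} {grade : (Fin d → ℕ) → ℕ}

theorem le_grade (hgrade : grade = maxDegree ∨ grade = totalDegree) (α : Fin d → ℕ) (i : Fin d) :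
    α i ≤ grade α := by
  rcases hgrade with h | h
  · rw [h]; exact Finset.le_sup (f := α) (Finset.mem_univ i)
  · rw [h]; exact Finset.single_le_sum (f := α) (fun _ _ => Nat.zero_le _) (Finset.mem_univ i)

theorem grade_mono (hgrade : grade = maxDegree ∨ grade = totalDegree) : Monotone grade := by
  intro α β hαβ
  rcases hgrade with h | h
  · rw [h]; exact Finset.sup_mono_fun fun i _ => hαβ i
  · rw [h]; exact Finset.sum_le_sum fun i _ => hαβ i

theorem grade_le_mul (hd : 0 < d) (hgrade : grade = maxDegree ∨ grade = totalDegree)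
    {α : Fin d → ℕ} {t : ℕ} (hα : ∀ i, α i ≤ t) : grade α ≤ d * t := by
  rcases hgrade with h | h
  · rw [h]; exact (Finset.sup_le fun i _ => hα i).trans (Nat.le_mul_of_pos_left t hd)
  · rw [h]
    simpa [totalDegree] using Finset.sum_le_card_nsmul Finset.univ α t fun i _ => hα i

theorem finite_gradedLexLT (hgrade : grade = maxDegree ∨ grade = totalDegree) (α : Fin d → ℕ) :
    {β | GradedLexLT grade β α}.Finite := by
  apply (Set.finite_Iic (fun _ : Fin d => grade α)).subset
  intro β hβ i
  refine (le_grade hgrade β i).trans ?_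
  rcases hβ with h | h
  · exact h.le
  · exact h.1.le

/-- Both gradings and the lexicographic order respect the coordinatewise order, so the first `p`
exponents form a lower set. -/
theorem gradedLexRank_mono (hgrade : grade = maxDegree ∨ grade = totalDegree) :
    Monotone (gradedLexRank grade) := by
  intro α β hαβ
  refine Set.ncard_le_ncard ?_ (finite_gradedLexLT hgrade β)
  intro γ hγ
  have hg := grade_mono hgrade hαβ
  rcases hγ with h | h
  · exact Or.inl (h.trans_le hg)
  · rcases hg.lt_or_eq with h' | h'
    · exact Or.inl (h.1 ▸ h')
    · exact Or.inr ⟨h.1.trans h', h.2.trans_le (Pi.toLex_monotone hαβ)⟩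

theorem gradedLexRank_lt_of_grade_lt (hgrade : grade = maxDegree ∨ grade = totalDegree)
    {α β : Fin d → ℕ} (h : grade α < grade β) : gradedLexRank grade α < gradedLexRank grade β := by
  refine Set.ncard_lt_ncard ⟨?_, fun hsub => ?_⟩ (finite_gradedLexLT hgrade β)
  · intro γ hγ
    rcases hγ with h' | h'
    · exact Or.inl (h'.trans h)
    · exact Or.inl (h'.1 ▸ h)
  · have hα : GradedLexLT grade α α := hsub (Or.inl h)
    rcases hα with h' | h'
    · exact lt_irrefl _ h'
    · exact lt_irrefl _ h'.2

theorem finite_boundaryExponents (hd : 0 < d)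
    (hgrade : grade = maxDegree ∨ grade = totalDegree) (p : ℕ) (i : Fin d) :
    (boundaryExponents grade p i).Finite := by
  have hinj : Function.Injective fun s : Fin d →₀ ℕ => gradedLexRank grade s :=
    (gradedLexRank_bijective hd grade hgrade).1.comp DFunLike.coe_injective
  exact ((Set.finite_Iio p).preimage hinj.injOn).subset fun s hs => hs.1

/-- The grade `g` of the last exponent controls both sides: every coordinate among the first `p`
exponents is at most `g`, while a box of side about `g / d` has smaller grades and so fits among
them. -/
theorem exists_pow_le_and_lt (hd : 0 < d) (hgrade : grade = maxDegree ∨ grade = totalDegree)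
    {p : ℕ} (hp : 1 ≤ p) :
    ∃ s : ℕ, s ^ d ≤ p ∧ ∀ α : Fin d → ℕ, gradedLexRank grade α < p → ∀ j, α j < 2 * d * s := by
  have hrank := gradedLexRank_bijective hd grade hgrade
  obtain ⟨α₀, hα₀⟩ := hrank.2 (p - 1)
  -- Coordinates at most `(g - 1) / d` have grade at most `g - 1`. When `g = 0`, truncated
  -- subtraction gives side `1`. The factor `2` in the coordinate bound absorbs the off-by-one in `g
  -- ≤ d * s`.
  refine ⟨(grade α₀ - 1) / d + 1, ?_, fun α hα j => ?_⟩
  · rcases Nat.eq_zero_or_pos (grade α₀) with h0 | hpos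
    · simpa [h0] using hp
    have hcard : (Fintype.piFinset fun _ : Fin d =>
        Finset.range ((grade α₀ - 1) / d + 1)).card ≤ (Finset.range p).card := by
      refine Finset.card_le_card_of_injOn (gradedLexRank grade) (fun β hβ => ?_) hrank.1.injOn
      have hβ' : ∀ i, β i ≤ (grade α₀ - 1) / d := fun i =>
        Nat.lt_succ_iff.mp (Finset.mem_range.mp (Fintype.mem_piFinset.mp hβ i))
      have h1 := grade_le_mul hd hgrade hβ'
      have h2 := Nat.mul_div_le (grade α₀ - 1) d
      have h3 := gradedLexRank_lt_of_grade_lt hgrade (α := β) (β := α₀) (by lia)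
      simp only [Finset.coe_range, Set.mem_Iio]
      lia
    simpa using hcard
  · have h1 : grade α ≤ grade α₀ := by
      by_contra! h
      have := gradedLexRank_lt_of_grade_lt hgrade h
      lia
    have h2 := le_grade hgrade α j
    have h3 := Nat.lt_mul_div_succ (grade α₀ - 1) hd
    have h4 : d * 1 ≤ d * ((grade α₀ - 1) / d + 1) := Nat.mul_le_mul_left d (by lia)
    rw [mul_assoc]
    lia

/-- Each line in direction `i` leaves a lower set at most once, so erasing the `i`-th coordinate is
injective on the boundary. -/
theorem ncard_boundaryExponents_le_pow (hgrade : grade = maxDegree ∨ grade = totalDegree)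
    {p b : ℕ} (hb : ∀ α : Fin d → ℕ, gradedLexRank grade α < p → ∀ j, α j < b) (i : Fin d) :
    (boundaryExponents grade p i).ncard ≤ b ^ (d - 1) := by
  set T : Finset (Fin d → ℕ) :=
    Fintype.piFinset fun j => if j = i then {0} else Finset.range b with hT
  have hTcard : T.card = b ^ (d - 1) := by
    simp_rw [hT, Fintype.card_piFinset, apply_ite Finset.card, Finset.card_singleton,
      Finset.card_range]
    rw [Finset.prod_ite]
    simp [Finset.filter_ne', Finset.card_erase_of_mem]
  rw [← hTcard, ← Set.ncard_coe_finset]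
  refine Set.ncard_le_ncard_of_injOn (fun s => Function.update (s : Fin d → ℕ) i 0) ?_ ?_
    T.finite_toSet
  · intro s hs
    rw [Finset.mem_coe, hT, Fintype.mem_piFinset]
    intro j
    by_cases hj : j = i
    · subst hj; simp
    · simpa [hj] using hb s hs.1 j
  · have hlt : ∀ s ∈ boundaryExponents grade p i, ∀ t ∈ boundaryExponents grade p i,
        (∀ j, j ≠ i → s j = t j) → ¬ s i < t i := by
      intro s hs t ht hst hlt
      -- On a common line, `s i < t i` gives `s + e_i ≤ t`, so `s + e_i` would not have left the
      -- set.
      refine hs.2 (lt_of_le_of_lt (gradedLexRank_mono hgrade fun j => ?_) ht.1)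
      by_cases hj : j = i
      · subst hj; simpa using hlt
      · simp [Ne.symm hj, hst j hj]
    intro s hs t ht hst
    have hst' : ∀ j, j ≠ i → s j = t j := fun j hj => by
      simpa [hj] using congrFun hst j
    ext j
    by_cases hj : j = i
    · subst hj
      exact le_antisymm (not_lt.mp (hlt t ht s hs fun l hl => (hst' l hl).symm))
        (not_lt.mp (hlt s hs t ht hst'))
    · exact hst' j hj

theorem ncard_boundaryExponents_le (hd : 0 < d)
    (hgrade : grade = maxDegree ∨ grade = totalDegree) {p : ℕ} (hp : 1 ≤ p) (i : Fin d) :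
    ((boundaryExponents grade p i).ncard : ℝ)
      ≤ (2 * d : ℝ) ^ (d - 1) * (p : ℝ) ^ (1 - 1 / (d : ℝ)) := by
  obtain ⟨s, hs, hb⟩ := exists_pow_le_and_lt hd hgrade hp
  have hd' : (1 : ℝ) ≤ d := by exact_mod_cast hd
  have h1 : ((boundaryExponents grade p i).ncard : ℝ) ≤ ((2 * d * s : ℕ) : ℝ) ^ (d - 1) := by
    exact_mod_cast ncard_boundaryExponents_le_pow hgrade hb i
  refine h1.trans ?_
  push_cast
  rw [mul_pow]
  gcongr
  -- This rewrites `s^(d-1)` as `(s^d)^(1-1/d)`, to which `s^d ≤ p` applies.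
  have hexp : ((d - 1 : ℕ) : ℝ) = d * (1 - 1 / (d : ℝ)) := by
    rw [Nat.cast_sub hd]
    field_simp
    simp
  rw [← Real.rpow_natCast, hexp, Real.rpow_mul (by positivity), Real.rpow_natCast]
  refine Real.rpow_le_rpow (by positivity) (by exact_mod_cast hs) ?_
  rw [sub_nonneg, div_le_one (by positivity)]
  exact hd'

end Counting

/-! ### The reference measure and the ensemble -/

section Ensemble

variable {d : ℕ} {q : Fin d → ℝ → ℝ} {grade : (Fin d → ℕ) → ℕ}

theorem measurable_prodDensity (hq_meas : ∀ i, Measurable (q i)) :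
    Measurable (prodDensity q) := by
  unfold prodDensity
  exact Finset.measurable_fun_prod _ fun i _ => (hq_meas i).comp (by fun_prop)

theorem measurableSet_cube : MeasurableSet (cube d) := by
  have : cube d = ⋂ i, (fun x : EuclideanSpace ℝ (Fin d) => x i) ⁻¹' Set.Icc (-1) 1 := by
    ext x
    simp only [cube, Set.mem_ofPred_eq, Set.mem_iInter, Set.mem_preimage]
  rw [this]
  exact MeasurableSet.iInter fun i => measurableSet_Icc.preimage (by fun_prop)

theorem integrableOn_prodDensity (hq_int : ∀ i, IntegrableOn (q i) (Set.Icc (-1) 1)) :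
    IntegrableOn (prodDensity q) (cube d) := by
  have h1 : Integrable (fun y : Fin d → ℝ => ∏ i, q i (y i))
      (Measure.pi fun _ : Fin d => volume.restrict (Set.Icc (-1 : ℝ) 1)) :=
    Integrable.fintype_prod fun i => hq_int i
  rw [← Measure.restrict_pi_pi, ← volume_pi] at h1
  have h2 := (PiLp.volume_preserving_ofLp (Fin d)).integrableOn_comp_preimage
    (MeasurableEquiv.toLp 2 (Fin d → ℝ)).symm.measurableEmbedding
    (f := fun y : Fin d → ℝ => ∏ i, q i (y i))
    (s := Set.univ.pi fun _ => Set.Icc (-1 : ℝ) 1)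
  have hcube : cube d = WithLp.ofLp ⁻¹' (Set.univ.pi fun _ => Set.Icc (-1 : ℝ) 1) := by
    ext x
    simp only [cube, Set.mem_ofPred_eq, Set.mem_preimage, Set.mem_univ_pi]
  rw [hcube]
  exact h2.mpr h1

theorem isFiniteMeasure_refMeasure (hq_int : ∀ i, IntegrableOn (q i) (Set.Icc (-1) 1)) :
    IsFiniteMeasure (refMeasure q) :=
  isFiniteMeasure_withDensity_ofReal (integrableOn_prodDensity hq_int).2

theorem ae_refMeasure (hq_meas : ∀ i, Measurable (q i)) :
    ∀ᵐ x ∂(refMeasure q), x ∈ {w | w ∈ cube d ∧ 0 < prodDensity q w} := by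
  rw [refMeasure, ae_withDensity_iff (measurable_prodDensity hq_meas).ennreal_ofReal]
  filter_upwards [ae_restrict_mem measurableSet_cube] with x hx hne
  exact ⟨hx, ENNReal.ofReal_pos.mp (pos_iff_ne_zero.mpr hne)⟩

theorem opeLaw_eq (p : ℕ) : opeLaw grade q p = projectionDPP (refMeasure q)
    (projKernel fun (k : Fin p) x => evalAt x (orthoPoly grade (refMeasure q) k)) p := by
  rw [opeLaw]
  congr 1
  ext x y
  rw [kernelQ, opeKernel, projKernel, Finset.sum_range]

/-- A zero polynomial would give a zero row, hence a zero density and a zero measure. Nondegeneracy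
of Gram–Schmidt thus follows from the ensemble being a probability law. -/
theorem orthoPoly_ne_zero_of_isProbabilityMeasure (p : ℕ)
    [IsProbabilityMeasure (opeLaw grade q p)] :
    ∀ k < p, orthoPoly grade (refMeasure q) k ≠ 0 := by
  intro k hk h0
  refine IsProbabilityMeasure.ne_zero (opeLaw grade q p) ?_
  rw [opeLaw_eq, projectionDPP]
  refine (congrArg _ (funext fun x => ?_)).trans withDensity_zero
  rw [det_projKernel_eq_sq, Matrix.det_eq_zero_of_row_eq_zero ⟨k, hk⟩ fun j => by
    simp [h0, evalAt]]
  simp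

theorem vectorVariance_opeLaw_le (hd : 0 < d)
    (hgrade : grade = maxDegree ∨ grade = totalDegree) (hq_meas : ∀ i, Measurable (q i))
    (hq_int : ∀ i, IntegrableOn (q i) (Set.Icc (-1) 1)) {p : ℕ} (hp : 1 ≤ p)
    [IsProbabilityMeasure (opeLaw grade q p)] {m : ℕ}
    {F : EuclideanSpace ℝ (Fin d) → EuclideanSpace ℝ (Fin m)} {B M : ℝ≥0}
    (hB : ∀ w ∈ {w | w ∈ cube d ∧ 0 < prodDensity q w}, ‖F w‖ ≤ B)
    (hM : LipschitzOnWith M F {w | w ∈ cube d ∧ 0 < prodDensity q w}) :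
    vectorVariance (fun x : Fin p → EuclideanSpace ℝ (Fin d) => (p : ℝ)⁻¹ • ∑ j, F (x j))
      (opeLaw grade q p)
      ≤ ENNReal.ofReal ((d * (2 * d : ℝ) ^ (d - 1)) * M ^ 2 *
        (p : ℝ) ^ (-(1 + 1 / (d : ℝ)))) := by
  set S := {w : EuclideanSpace ℝ (Fin d) | w ∈ cube d ∧ 0 < prodDensity q w} with hS
  have := isFiniteMeasure_refMeasure hq_int
  have hSμ : ∀ᵐ x ∂(refMeasure q), x ∈ S := ae_refMeasure hq_meas
  have hμ : ∀ᵐ x ∂(refMeasure q), x ∈ cube d := hSμ.mono fun x hx => hx.1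
  have hSmeas : MeasurableSet S :=
    measurableSet_cube.inter (measurableSet_lt measurable_const (measurable_prodDensity hq_meas))
  have hne := orthoPoly_ne_zero_of_isProbabilityMeasure (grade := grade) (q := q) p
  have hφm : ∀ k : Fin p, Measurable fun x => evalAt x (orthoPoly grade (refMeasure q) k) :=
    fun k => measurable_evalAt _
  have hφ : ∀ k : Fin p, MemLp (fun x => evalAt x (orthoPoly grade (refMeasure q) k)) ⊤
      (refMeasure q) := fun k => memLp_top_evalAt hμ _
  have hon : ∀ k l : Fin p, ∫ x, evalAt x (orthoPoly grade (refMeasure q) k) *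
      evalAt x (orthoPoly grade (refMeasure q) l) ∂(refMeasure q) = if k = l then 1 else 0 := by
    intro k l
    rw [← orthonormal_iff_ite.mp (orthonormal_orthoPoly hμ hne) k l, inner_polyToL2]
    rfl
  -- Measurability comes from continuity on `S`, which carries all the mass.
  have hFm : AEStronglyMeasurable F (refMeasure q) := by
    rw [← Measure.restrict_eq_self_of_ae_mem hSμ]
    exact hM.continuousOn.aestronglyMeasurable hSmeas
  -- The bound `B` serves only for integrability; it does not enter the final constant.
  have hF : ∀ c, MemLp (fun x => F x c) ⊤ (refMeasure q) := by
    intro c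
    refine memLp_top_of_bound ((EuclideanSpace.proj (𝕜 := ℝ) c).continuous.comp_aestronglyMeasurable
      hFm) B ?_
    filter_upwards [hSμ] with x hx
    exact (PiLp.norm_apply_le (F x) c).trans (hB x hx)
  have hcoord := memLp_top_coord hμ
  have hlaw := opeLaw_eq (grade := grade) (q := q) p
  have : IsProbabilityMeasure (projectionDPP (refMeasure q)
      (projKernel fun (k : Fin p) x => evalAt x (orthoPoly grade (refMeasure q) k)) p) := by
    rw [← hlaw]; infer_instance
  rw [hlaw, vectorVariance_smul_sum_projectionDPP hφm hφ hon hF]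
  apply ENNReal.ofReal_le_ofReal
  have hcomp := sum_blockVariance_le hφ hon hF hcoord ((M : ℝ) ^ 2) (by
    filter_upwards [Measure.quasiMeasurePreserving_fst.ae hSμ,
      Measure.quasiMeasurePreserving_snd.ae hSμ] with z h1 h2
    have h := hM.dist_le_mul _ h1 _ h2
    rw [dist_eq_norm, dist_eq_norm] at h
    have h' := pow_le_pow_left₀ (norm_nonneg _) h 2
    rw [mul_pow, EuclideanSpace.norm_sq_eq, EuclideanSpace.norm_sq_eq] at h'
    simpa using h')
  have hcount : ∑ i, blockVariance (refMeasure q)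
      (fun (k : Fin p) x => evalAt x (orthoPoly grade (refMeasure q) k)) (fun x => x i)
      ≤ d * ((2 * d : ℝ) ^ (d - 1) * (p : ℝ) ^ (1 - 1 / (d : ℝ))) := by
    refine (Finset.sum_le_card_nsmul _ _ _ fun i _ =>
      (blockVariance_coord_le hμ (gradedLexRank_bijective hd grade hgrade) hne i
        (finite_boundaryExponents hd hgrade p i)).trans
          (ncard_boundaryExponents_le hd hgrade hp i)).trans (le_of_eq ?_)
    simp
  have hp' : (0 : ℝ) < p := by exact_mod_cast hp
  have hpow : ((p : ℝ)⁻¹) ^ 2 * (p : ℝ) ^ (1 - 1 / (d : ℝ)) = (p : ℝ) ^ (-(1 + 1 / (d : ℝ))) := by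
    rw [inv_pow, ← Real.rpow_natCast, ← Real.rpow_neg hp'.le, ← Real.rpow_add hp']
    congr 1
    push_cast
    ring
  calc _ ≤ ((p : ℝ)⁻¹) ^ 2 * ((M : ℝ) ^ 2 *
        (d * ((2 * d : ℝ) ^ (d - 1) * (p : ℝ) ^ (1 - 1 / (d : ℝ))))) := by
        gcongr
        exact hcomp.trans (by gcongr)
    _ = _ := by
        rw [← hpow]
        ring

theorem smoothedEstimator_eq {m N p : ℕ} (hp : 1 ≤ p)
    (loss : EuclideanSpace ℝ (Fin d) → EuclideanSpace ℝ (Fin m) → ℝ)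
    (k : EuclideanSpace ℝ (Fin d) → ℝ) (h : ℝ) (θ : EuclideanSpace ℝ (Fin m))
    (data : Fin N → EuclideanSpace ℝ (Fin d)) :
    (smoothedEstimator grade q loss k h θ data : (Fin p → _) → _)
      = fun A => (p : ℝ)⁻¹ • ∑ j, normalizedGradient grade q p loss k h data θ (A j) := by
  have hp' : (p : ℝ) ≠ 0 := by exact_mod_cast (Nat.one_le_iff_ne_zero.mp hp)
  ext1 A
  rw [smoothedEstimator, Finset.smul_sum]
  refine Finset.sum_congr rfl fun j _ => ?_
  rw [normalizedGradient, smul_smul]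
  congr 1
  simp only [mul_inv, one_div, inv_inv]
  field_simp

end Ensemble

/-! ### Conditioning on the data, and the bound in probability -/

theorem condDistrib_ae_eq_map_of_indepFun {Ω R S : Type*} [MeasurableSpace Ω] [MeasurableSpace R]
    [MeasurableSpace S] [StandardBorelSpace S] [Nonempty S] {P : Measure Ω}
    [IsProbabilityMeasure P] {D : Ω → R} {A : Ω → S} (hD : Measurable D) (hA : Measurable A)
    (hind : IndepFun A D P) : ∀ᵐ ω ∂P, condDistrib A D P (D ω) = P.map A := by
  have : IsProbabilityMeasure (P.map A) := Measure.isProbabilityMeasure_map hA.aemeasurable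
  have h : condDistrib A D P =ᵐ[P.map D] Kernel.const R (P.map A) := by
    rw [condDistrib_ae_eq_iff_measure_eq_compProd D hA.aemeasurable, Measure.compProd_const]
    exact (indepFun_iff_map_prod_eq_prod_map_map hD.aemeasurable hA.aemeasurable).mp hind.symm
  filter_upwards [ae_of_ae_map hD.aemeasurable h] with ω hω
  rw [hω, Kernel.const_apply]

end OPESmoothed

theorem mainTheorem3
    {d m : ℕ} (hd : 0 < d)
    (grade : (Fin d → ℕ) → ℕ)
    (hgrade : grade = OPESmoothed.maxDegree ∨ grade = OPESmoothed.totalDegree)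
    (q : Fin d → ℝ → ℝ)
    (hq_meas : ∀ i, Measurable (q i))
    (hq_nonneg : ∀ i, ∀ x ∈ Set.Icc (-1 : ℝ) 1, 0 ≤ q i x)
    (hq_int : ∀ i, ∫ x in Set.Icc (-1 : ℝ) 1, q i x = 1)
    (k : EuclideanSpace ℝ (Fin d) → ℝ)
    (γ : Measure (EuclideanSpace ℝ (Fin d))) [IsProbabilityMeasure γ]
    (Θ : Set (EuclideanSpace ℝ (Fin m)))
    (loss : EuclideanSpace ℝ (Fin d) → EuclideanSpace ℝ (Fin m) → ℝ)
    (hloss : ∀ᵐ z ∂γ, ∀ θ ∈ Θ, DifferentiableAt ℝ (loss z) θ)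
    (p : ℕ → ℕ) (hp : ∀ N, 1 ≤ p N)
    (h : ℕ → ℝ) (hh : ∀ N, 0 < h N)
    {Ω : Type*} [MeasurableSpace Ω] (P : Measure Ω) [IsProbabilityMeasure P]
    (z : ℕ → Ω → EuclideanSpace ℝ (Fin d))
    (hz_meas : ∀ i, Measurable (z i))
    (hz_indep : iIndepFun z P)
    (hz_law : ∀ i, P.map (z i) = γ)
    (A : (N : ℕ) → Ω → Fin (p N) → EuclideanSpace ℝ (Fin d))
    (hA_meas : ∀ N, Measurable (A N))
    (hA_law : ∀ N, P.map (A N) = OPESmoothed.opeLaw grade q (p N))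
    (hA_indep : ∀ N, IndepFun (A N) (fun ω (i : Fin N) => z i ω) P)
    (B M : ℕ → Ω → ℝ≥0)
    (hB : OPESmoothed.IsBigOP P (fun N ω => (B N ω : ℝ≥0∞)) (fun _ => 1))
    (hM : OPESmoothed.IsBigOP P (fun N ω => (M N ω : ℝ≥0∞)) (fun _ => 1))
    (hbound : ∀ N, ∀ᵐ ω ∂P, ∀ θ ∈ Θ,
      ∀ w ∈ {w | w ∈ OPESmoothed.cube d ∧ 0 < OPESmoothed.prodDensity q w},
        ‖OPESmoothed.normalizedGradient grade q (p N) loss k (h N)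
          (fun i : Fin N => z i ω) θ w‖ ≤ B N ω)
    (hlip : ∀ N, ∀ᵐ ω ∂P, ∀ θ ∈ Θ,
      LipschitzOnWith (M N ω)
        (OPESmoothed.normalizedGradient grade q (p N) loss k (h N) (fun i : Fin N => z i ω) θ)
        {w | w ∈ OPESmoothed.cube d ∧ 0 < OPESmoothed.prodDensity q w}) :
    OPESmoothed.IsBigOP P
      (fun N ω => ⨆ θ ∈ Θ,
        OPESmoothed.condVariance P (fun ω' (i : Fin N) => z i ω') (A N)
          (OPESmoothed.smoothedEstimator grade q loss k (h N) θ) ω)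
      (fun N => ENNReal.ofReal ((p N : ℝ) ^ (-(1 + 1 / (d : ℝ))))) := by
  -- The integral of a non-integrable function is `0` by convention, so the value `1` forces
  -- integrability.
  have hq_int' : ∀ i, IntegrableOn (q i) (Set.Icc (-1) 1) := fun i => by
    by_contra hcon
    have := hq_int i
    rw [integral_undef hcon] at this
    exact zero_ne_one this
  set K : ℝ := d * (2 * d : ℝ) ^ (d - 1) with hK
  have hK0 : 0 ≤ K := by positivity
  -- The exceptional null set does not depend on `θ`, so the supremum is bounded without any
  -- measurability in `θ`.
  have hmain : ∀ N, ∀ᵐ ω ∂P, (⨆ θ ∈ Θ,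
      OPESmoothed.condVariance P (fun ω' (i : Fin N) => z i ω') (A N)
        (OPESmoothed.smoothedEstimator grade q loss k (h N) θ) ω)
      ≤ ENNReal.ofReal (K * M N ω ^ 2 * (p N : ℝ) ^ (-(1 + 1 / (d : ℝ)))) := by
    intro N
    have hD : Measurable fun ω (i : Fin N) => z i ω := measurable_pi_lambda _ fun i => hz_meas i
    have : IsProbabilityMeasure (OPESmoothed.opeLaw grade q (p N)) := by
      rw [← hA_law N]
      exact Measure.isProbabilityMeasure_map (hA_meas N).aemeasurable
    filter_upwards [hbound N, hlip N,
      OPESmoothed.condDistrib_ae_eq_map_of_indepFun hD (hA_meas N) (hA_indep N)] with ω hb hl hc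
    refine iSup₂_le fun θ hθ => ?_
    rw [OPESmoothed.condVariance, hc, hA_law N, OPESmoothed.smoothedEstimator_eq (hp N)]
    exact OPESmoothed.vectorVariance_opeLaw_le hd hgrade hq_meas hq_int' (hp N) (hb θ hθ) (hl θ hθ)
  intro ε hε
  obtain ⟨C, hC⟩ := hM ε hε
  -- With this constant, exceeding the threshold forces `C < M N ω` almost surely, so the tail bound
  -- for `M` transfers.
  refine ⟨(K * C ^ 2).toNNReal, ?_⟩
  filter_upwards [hC] with N hN
  refine le_trans (measure_mono_ae ?_) hN
  filter_upwards [hmain N] with ω hω hlt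
  have hlt' := lt_of_lt_of_le hlt hω
  rw [← ENNReal.ofReal, ← ENNReal.ofReal_mul (by positivity)] at hlt'
  have h1 := (ENNReal.ofReal_lt_ofReal_iff_of_nonneg (by positivity)).mp hlt'
  have h2 := lt_of_mul_lt_mul_right h1 (by positivity)
  have h3 := lt_of_mul_lt_mul_left h2 hK0
  have h4 : (C : ℝ) < M N ω := lt_of_pow_lt_pow_left₀ 2 (by positivity) h3
  change (C : ℝ≥0∞) * 1 < (M N ω : ℝ≥0∞)
  rw [mul_one]
  exact_mod_cast h4
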